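/- **Proposition 6.1 (Family of spacetimes with curvature unbounded below).** Fix positive constants $\iota_0, K_n, K_{\mathrm{Rm}}, K_\pi, K_\omega$. There are a point $p\in\mathbb R^4$, a number $L\ge 1$ and a compact set $K\subset\mathbb R^4$ such that for every $C\in\mathbb R$ there exist a smooth function $H=H(u,x,y)$ on $\mathbb R^3$ and a foliation of $\mathbb R^4$ by the level sets $\mathcal H_t=\{\tau=t\}$ of a smooth time function $\tau$ for which the plane-wave metric on $\mathbb R^4$ $$ g=-2\,du\,dv+2H(u,x,y)\,du^2+dx^2+dy^2 $$ has the following properties. Put $I=[-L,0]$, $M_I=\{\tau\in I\}$, let $n=(-g(d\tau,d\tau))^{-1/2}$ be the lapse, $T$ the future unit normal, $g(T,\cdot)=-n\,d\tau$, and $g_T=g+2g(T,\cdot)\otimes g(T,\cdot)$; let $\phi_t:\mathcal H_0\to\mathcal H_t$ be the diffeomorphism obtained by following the integral curves of $T$, and $g_t=\phi_t^*(g|_{\mathcal H_t})$. For a causal vector $X$, the curvature operator $\mathrm{Rm}_X$ on $X^\perp$ is given by $\langle \mathrm{Rm}_X(Y),Y\rangle=\langle \mathrm{Rm}(X,Y)Y,X\rangle$,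 where $\mathrm{Rm}(X,Y)Z=\nabla_X\nabla_YZ-\nabla_Y\nabla_XZ-\nabla_{[X,Y]}Z$. (1) *All assumptions of the null injectivity estimate hold with the given constants:* $g$ is a geodesically complete, globally hyperbolic Lorentzian metric, all $\mathcal H_t$ are Cauchy hypersurfaces and are carried to each other by the flow of $T$ (with $\mathcal H_0$ diffeomorphic to $\mathbb R^3$), $p\in\mathcal H_0$, and - $\mathrm{Inj}(p,\mathcal H_0,g_0)\ge\iota_0$; - $n\le K_n$ in $M_I$; - $\langle \mathrm{Rm}_X(Y),Y\rangle\le K_{\mathrm{Rm}}\langle Y,Y\rangle$ for every tangent vector $X$, at a point of $M_I$, of a past null geodesic issuing from $p$ and parametrized by $\tau$, and every $Y\perp X$; - the deformation tensor $\pi=\mathcal L_Tg$ satisfies $|\pi(V,V)|\le K_\pi\, g_T(V,V)$ for all tangent vectors $V$ in $M_I$; - $\omega=\nabla^{g_t}-\nabla^{g_0}$ satisfies $|\omega(V,V)|_{g_T}\le K_\omega\, g_T(V,V)$ for $t\in I$ and all spacelike or null $V$ at points of $\mathcal H_t$ (on the left, $\omega$ is transported to $\mathcal H_t$ by $\phi_t$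 and evaluated on the projection of $V$ tangent to $\mathcal H_t$). (2) *The curvature operator is non-positive:* the Hessian of $H$ in $(x,y)$ is positive semidefinite everywhere, and $\langle\mathrm{Rm}_X(Y),Y\rangle\le 0$ for all causal $X$ and all $Y\perp X$. (3) *The curvature operator is not uniformly bounded below:* there are a tangent vector $X$ of a $\tau$-parametrized past null geodesic from $p$, at a point of $M_I$, and a vector $Y\perp X$ with $\langle\mathrm{Rm}_X(Y),Y\rangle<-C\langle Y,Y\rangle$. (4) *Not even in $L^2$:* $K\subset J^-(p)\cap M_I$; at some point of $K$ both $H_{xx}>C$ and $H_{yy}>C$; and every function $b$ on $\mathbb R^4$ such that $\langle\mathrm{Rm}_X(Y),Y\rangle\ge -b(q)\langle Y,Y\rangle$ for all $q\in K$, all null $X\in T_q\mathbb R^4$ with $d\tau(X)=1$ and all $Y\perp X$, satisfies $\int_K (b^+)^2\,dV_g>C$, where $b^+=\max(b,0)$ and the integral (which may be $+\infty$) is the lower integral if $b$ is not measurable. Here $p$, $L$ and $K$ depend only on the five constants and not on $C$. -/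

import Mathlib

open Set Filter Topology MeasureTheory
open scoped ContDiff ENNReal

noncomputable section

/-- Coordinate space `ℝ^d`, carrying the global coordinates of the manifolds considered. -/
abbrev Coord (d : ℕ) : Type := Fin d → ℝ

/-- A field of bilinear forms on `ℝ^d`, given by its components `g_{ij}`. -/
abbrev MetricField (d : ℕ) : Type := Coord d → Matrix (Fin d) (Fin d) ℝ

/-- The partial derivative `∂_i f` at `q`. -/
def pd {d : ℕ} (i : Fin d) (f : Coord d → ℝ) (q : Coord d) : ℝ :=
  fderiv ℝ f q (Pi.single i 1)

namespace MetricField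

variable {d : ℕ}

/-- The scalar product `⟨X, Y⟩_g` at `q`. -/
def ip (g : MetricField d) (q X Y : Coord d) : ℝ :=
  ∑ i, ∑ j, g q i j * X i * Y j

/-- The components are smooth functions. -/
def IsSmooth (g : MetricField d) : Prop :=
  ∀ i j, ContDiff ℝ ∞ (fun q => g q i j)

/-- A smooth Lorentzian metric of signature `(-, +, …, +)` on `ℝ^(m+1)`. -/
def IsLorentzian {m : ℕ} (g : MetricField (m + 1)) : Prop :=
  g.IsSmooth ∧ ∀ q, ∃ P : Matrix (Fin (m + 1)) (Fin (m + 1)) ℝ, IsUnit P.det ∧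
    P.transpose * g q * P = Matrix.diagonal (fun i => if i = 0 then -1 else 1)

/-- Christoffel symbols `Γ^k_{ij}` of the Levi-Civita connection. -/
def christoffel (g : MetricField d) (q : Coord d) (k i j : Fin d) : ℝ :=
  (1 / 2 : ℝ) * ∑ l, (g q)⁻¹ k l *
    (pd i (fun r => g r l j) q + pd j (fun r => g r l i) q - pd l (fun r => g r i j) q)

/-- The vector `Γ^k_{ij} V^i W^j`. -/
def christoffelVec (g : MetricField d) (q V W : Coord d) : Coord d :=
  fun k => ∑ i, ∑ j, g.christoffel q k i j * V i * W j

/-- Components `R^l_{kij}` of the curvature tensor, with the sign convention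
`Rm(X, Y) Z = ∇_X ∇_Y Z - ∇_Y ∇_X Z - ∇_[X,Y] Z` and `Rm(∂_i, ∂_j) ∂_k = R^l_{kij} ∂_l`. -/
def riemann (g : MetricField d) (q : Coord d) (l k i j : Fin d) : ℝ :=
  pd i (fun r => g.christoffel r l j k) q - pd j (fun r => g.christoffel r l i k) q
    + ∑ m, (g.christoffel q l i m * g.christoffel q m j k
          - g.christoffel q l j m * g.christoffel q m i k)

/-- The vector `Rm(X, Y) Z` at `q`. -/
def curvature (g : MetricField d) (q X Y Z : Coord d) : Coord d :=
  fun l => ∑ i, ∑ j, ∑ k, g.riemann q l k i j * X i * Y j * Z k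

/-- The quadratic form `⟨Rm_X(Y), Y⟩ = ⟨Rm(X, Y) Y, X⟩` of the curvature operator `Rm_X`. -/
def curvatureForm (g : MetricField d) (q X Y : Coord d) : ℝ :=
  g.ip q (g.curvature q X Y Y) X

/-- The volume measure `√|det g| dx`. -/
def vol (g : MetricField d) : Measure (Coord d) :=
  (volume : Measure (Coord d)).withDensity (fun q => ENNReal.ofReal (Real.sqrt |(g q).det|))

/-- `γ` is an affinely parametrized geodesic on the parameter set `J`, with velocity `V`. -/
def IsGeodesicOn (g : MetricField d) (γ V : ℝ → Coord d) (J : Set ℝ) : Prop :=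
  ∀ s ∈ J, HasDerivWithinAt γ (V s) J s ∧
    HasDerivWithinAt V (-(g.christoffelVec (γ s) (V s) (V s))) J s

/-- Every geodesic is defined for all values of the affine parameter. -/
def IsGeodesicallyComplete (g : MetricField d) : Prop :=
  ∀ q W : Coord d, ∃ γ V : ℝ → Coord d, g.IsGeodesicOn γ V univ ∧ γ 0 = q ∧ V 0 = W

/-- The open ball of radius `r` about `0` in the tangent space at `p`. -/
def tangentBall (g : MetricField d) (p : Coord d) (r : ℝ) : Set (Coord d) :=
  {v | Real.sqrt (g.ip p v v) < r}

/-- The exponential map `v ↦ γ_v(1)` at `p` is defined on the ball of radius `r` and is a smooth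
diffeomorphism from it onto an open subset. -/
def ExpIsDiffeoOnBall (g : MetricField d) (p : Coord d) (r : ℝ) : Prop :=
  ∃ e einv : Coord d → Coord d,
    (∀ v ∈ g.tangentBall p r, ∃ γ V : ℝ → Coord d,
      g.IsGeodesicOn γ V (Icc 0 1) ∧ γ 0 = p ∧ V 0 = v ∧ γ 1 = e v) ∧
    ContDiffOn ℝ ∞ e (g.tangentBall p r) ∧
    IsOpen (e '' g.tangentBall p r) ∧
    ContDiffOn ℝ ∞ einv (e '' g.tangentBall p r) ∧
    LeftInvOn einv e (g.tangentBall p r)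

/-- The injectivity radius of a Riemannian metric at `p`. -/
def injRadius (g : MetricField d) (p : Coord d) : ℝ≥0∞ :=
  sSup {ρ | ∃ r : ℝ, ρ = ENNReal.ofReal r ∧ g.ExpIsDiffeoOnBall p r}

/-! ### Time functions, causality -/

/-- `g(dτ, dτ)`, computed with the inverse metric. -/
def gradSq (g : MetricField d) (τ : Coord d → ℝ) (q : Coord d) : ℝ :=
  ∑ i, ∑ j, (g q)⁻¹ i j * pd i τ q * pd j τ q

/-- The lapse function `n = (-g(dτ, dτ))^(-1/2)`. -/
def lapse (g : MetricField d) (τ : Coord d → ℝ) (q : Coord d) : ℝ :=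
  (Real.sqrt (-(g.gradSq τ q)))⁻¹

/-- The future unit normal `T`, determined by `g(T, ·) = -n dτ`. -/
def unitNormal (g : MetricField d) (τ : Coord d → ℝ) (q : Coord d) : Coord d :=
  fun i => -(g.lapse τ q * ∑ j, (g q)⁻¹ i j * pd j τ q)

/-- The reference Riemannian metric `g_T = g + 2 g(T, ·) ⊗ g(T, ·)`, as a quadratic form. -/
def refSq (g : MetricField d) (τ : Coord d → ℝ) (q V : Coord d) : ℝ :=
  g.ip q V V + 2 * (g.ip q (g.unitNormal τ q) V) ^ 2

/-- Components of the deformation tensor `π = 𝓛_T g`. -/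
def deformation (g : MetricField d) (τ : Coord d → ℝ) (q : Coord d) (i j : Fin d) : ℝ :=
  ∑ k, (g.unitNormal τ q k * pd k (fun r => g r i j) q
    + g q k j * pd i (fun r => g.unitNormal τ r k) q
    + g q i k * pd j (fun r => g.unitNormal τ r k) q)

/-- Future-directed causal vectors, for the time orientation given by `T`
(which makes `τ` increase towards the future). -/
def IsFutureCausal (g : MetricField d) (τ : Coord d → ℝ) (q V : Coord d) : Prop :=
  g.ip q V V ≤ 0 ∧ g.ip q (g.unitNormal τ q) V < 0

/-- A `C¹` future-directed causal curve with velocity `V` on the parameter set `J`. -/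
def IsCausalCurveOn (g : MetricField d) (τ : Coord d → ℝ) (γ V : ℝ → Coord d) (J : Set ℝ) : Prop :=
  ContinuousOn V J ∧
    ∀ s ∈ J, HasDerivWithinAt γ (V s) J s ∧ g.IsFutureCausal τ (γ s) (V s)

/-- The causal past `J⁻(p)`. -/
def causalPast (g : MetricField d) (τ : Coord d → ℝ) (p : Coord d) : Set (Coord d) :=
  {q | q = p ∨ ∃ γ V : ℝ → Coord d,
    g.IsCausalCurveOn τ γ V (Icc 0 1) ∧ γ 0 = q ∧ γ 1 = p}

/-- A Cauchy hypersurface: it is met exactly once by every causal curve that has no endpoint in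
either direction (such curves are parametrized by `ℝ`). A spacetime with a Cauchy hypersurface is
globally hyperbolic. -/
def IsCauchy (g : MetricField d) (τ : Coord d → ℝ) (S : Set (Coord d)) : Prop :=
  ∀ γ V : ℝ → Coord d, g.IsCausalCurveOn τ γ V univ →
    (¬ ∃ q, Tendsto γ atTop (𝓝 q)) → (¬ ∃ q, Tendsto γ atBot (𝓝 q)) →
    ∃! s, γ s ∈ S

/-- `X`, based at `q`, is a tangent vector of a null geodesic issuing from `p` towards the past,
parametrized by the time function `τ` (so `dτ(X) = 1`), at a point whose time lies in `I`. -/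
def IsNullConeTangent (g : MetricField d) (τ : Coord d → ℝ) (p : Coord d) (I : Set ℝ)
    (q X : Coord d) : Prop :=
  ∃ (γ V : ℝ → Coord d) (s : ℝ), g.IsGeodesicOn γ V univ ∧ γ 0 = p ∧
    g.ip p (V 0) (V 0) = 0 ∧ 0 < g.ip p (g.unitNormal τ p) (V 0) ∧
    0 ≤ s ∧ γ s = q ∧ τ q ∈ I ∧ X = (fderiv ℝ τ q (V s))⁻¹ • V s

/-! ### Foliations in transported coordinates -/

/-- `τ` is a time function on the spacetime and `Φ` is a transported coordinate system for its
level sets: `Φ (t, x)` lies on `{τ = t}`, and `t ↦ Φ (t, x)` is an integral curve of `T`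
(reparametrized by `τ`, that is, of `n T`). The initial slice `{τ = 0}` has the global coordinates
`x ∈ ℝ^m`. -/
structure IsTransported {m : ℕ} (g : MetricField (m + 1)) (τ : Coord (m + 1) → ℝ)
    (Φ : Coord (m + 1) → Coord (m + 1)) : Prop where
  smooth_time : ContDiff ℝ ∞ τ
  timelike : ∀ q, g.gradSq τ q < 0
  smooth : ContDiff ℝ ∞ Φ
  smooth_inv : ∃ Ψ : Coord (m + 1) → Coord (m + 1), ContDiff ℝ ∞ Ψ ∧
    Function.LeftInverse Ψ Φ ∧ Function.RightInverse Ψ Φ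
  time_eq : ∀ c, τ (Φ c) = c 0
  flow : ∀ c, fderiv ℝ Φ c (Pi.single 0 1) = g.lapse τ (Φ c) • g.unitNormal τ (Φ c)

/-- The metric `g_t` on the initial slice: the metric induced on `{τ = t}`, pulled back to
`{τ = 0}` along the integral curves of `T`. -/
def sliceMetric {m : ℕ} (g : MetricField (m + 1)) (Φ : Coord (m + 1) → Coord (m + 1)) (t : ℝ) :
    MetricField m :=
  fun x => Matrix.of fun i j =>
    g.ip (Φ (Fin.cons t x)) (fderiv ℝ Φ (Fin.cons t x) (Pi.single i.succ 1))
      (fderiv ℝ Φ (Fin.cons t x) (Pi.single j.succ 1))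

/-- The second deformation tensor `ω = ∇^{g_t} - ∇^{g_0}`, evaluated on `(W, W)`. -/
def secondDeformation {m : ℕ} (g : MetricField (m + 1)) (Φ : Coord (m + 1) → Coord (m + 1))
    (t : ℝ) (x W : Coord m) : Coord m :=
  (g.sliceMetric Φ t).christoffelVec x W W - (g.sliceMetric Φ 0).christoffelVec x W W

/-- All assumptions of the null injectivity estimate, for the pointed spacetime `(ℝ^(m+1), g, p)`
with the foliation `(τ, Φ)` of the region `M_I = {τ ∈ I}`. -/
structure SatisfiesAssumptions {m : ℕ} (g : MetricField (m + 1)) (τ : Coord (m + 1) → ℝ)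
    (Φ : Coord (m + 1) → Coord (m + 1)) (p : Coord (m + 1)) (I : Set ℝ)
    (ι₀ Kn KRm Kπ Kω : ℝ) : Prop where
  lorentzian : g.IsLorentzian
  complete : g.IsGeodesicallyComplete
  transported : g.IsTransported τ Φ
  cauchy : ∀ c : ℝ, g.IsCauchy τ {q | τ q = c}
  base : τ p = 0
  /-- Initial injectivity radius at `p`. -/
  injectivity : ∀ x : Coord m, Φ (Fin.cons 0 x) = p →
    ENNReal.ofReal ι₀ ≤ (g.sliceMetric Φ 0).injRadius x
  /-- Upper lapse bound on `M_I`. -/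
  lapse_le : ∀ q, τ q ∈ I → g.lapse τ q ≤ Kn
  /-- Upper bound on the curvature operator along the past null cone of `p`. -/
  null_curvature : ∀ q X, g.IsNullConeTangent τ p I q X → ∀ Y, g.ip q X Y = 0 →
    g.curvatureForm q X Y ≤ KRm * g.ip q Y Y
  /-- Bound on the deformation tensor on `M_I`. -/
  deformation_le : ∀ q, τ q ∈ I → ∀ V : Coord (m + 1),
    |∑ i, ∑ j, g.deformation τ q i j * V i * V j| ≤ Kπ * g.refSq τ q V
  /-- Bound on the second deformation tensor on `M_I`, for spacelike or null `V`. The vector `V` has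
  transported components `(a, W)`, so `W` is its projection to the slice; the norm of the
  slice-tangent vector `ω(V, V)` for `g_T` is its norm for `g_t`. -/
  second_deformation_le : ∀ t ∈ I, ∀ (x : Coord m) (a : ℝ) (W : Coord m),
    let V := fderiv ℝ Φ (Fin.cons t x) (Fin.cons a W)
    0 ≤ g.ip (Φ (Fin.cons t x)) V V →
    Real.sqrt ((g.sliceMetric Φ t).ip x (g.secondDeformation Φ t x W)
      (g.secondDeformation Φ t x W)) ≤ Kω * g.refSq τ (Φ (Fin.cons t x)) V

/-- `Rm_X ≥ -b(q)` for all `q ∈ K` and all null vectors `X` at `q`, normalized by `dτ(X) = 1`. -/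
def CurvatureBoundedBelowBy (g : MetricField d) (τ : Coord d → ℝ) (K : Set (Coord d))
    (b : Coord d → ℝ) : Prop :=
  ∀ q ∈ K, ∀ X, g.ip q X X = 0 → fderiv ℝ τ q X = 1 → ∀ Y, g.ip q X Y = 0 →
    -(b q) * g.ip q Y Y ≤ g.curvatureForm q X Y

end MetricField

/-- The profile `H(u, x, y)` as a function of the coordinates `(u, v, x, y)`. -/
def profile (H : ℝ → ℝ → ℝ → ℝ) (q : Coord 4) : ℝ := H (q 0) (q 2) (q 3)

/-- The plane-wave metric `-2 du dv + 2 H(u, x, y) du² + dx² + dy²`, in coordinates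
`(u, v, x, y)`. -/
def planeWave (H : ℝ → ℝ → ℝ → ℝ) : MetricField 4 := fun q =>
  !![2 * profile H q, -1, 0, 0;
     -1, 0, 0, 0;
     0, 0, 1, 0;
     0, 0, 0, 1]

/-- The Hessian of `H` in the transverse variables `x, y`. -/
def transverseHessian (H : ℝ → ℝ → ℝ → ℝ) (q : Coord 4) : Matrix (Fin 2) (Fin 2) ℝ :=
  !![pd 2 (pd 2 (profile H)) q, pd 2 (pd 3 (profile H)) q;
     pd 3 (pd 2 (profile H)) q, pd 3 (pd 3 (profile H)) q]

end

noncomputable section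

/-! Let the profile be H = f(ξ) with ξ = (3x + 4y)/5, and let η be the orthogonal transverse
coordinate. The curvature form is then −f''(ξ) times a square (`curvatureForm_planeWave_ridge`), so
convexity of f gives non-positivity. The Hessian has rank one, and the oblique direction makes both
of its diagonal entries large together. What remains is to find a foliation whose bounds do not see
f''.

Start from a scale factor P ≥ 1, put X' = P, S = X⁻¹, Q' = P², and define f by 1 + 2f(ξ) = P(S(ξ))².
Then nτ = u + v − Q(S(ξ)) solves the eikonal equation g(dτ, dτ) = −1/n², so the lapse is the
constant n. Following T gives coordinates (t, a, b, η) in which the metric is −n²dt² + da² + P(a + b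
+ nt)²db² + dη² (`ip_fderiv_chart`). Here the deformation tensor and ω are bounded by multiples of
sup P', and P ≥ 1 makes the slices Cauchy (`isCauchy_time`). The curvature, however, is carried by
f'' = P''/P, evaluated at S(ξ).

Now let P = 1 for s ≤ 0 and let P' rise from 0 to ε within [0, δ] (`exists_rosenProfile`). A small ε
meets all the bounds uniformly in δ. On a subinterval of length proportional to δ one has P'' ≥
ε/(2δ), so the supremum of the curvature grows at least like 1/δ and its squared L² norm at least
like ε²/δ; a small δ beats any C.

The point p lies at depth R = 2ι₀ in the region P = 1, so neither p nor the flat ball around it on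
the initial slice depends on δ. The compact set is a box at very negative v, from which straight
segments to p in transported coordinates are causal (`box_subset_causalPast`). -/

/-- The profile `f((3x + 4y) / 5)`, depending on one transverse direction only. -/
def ridge (f : ℝ → ℝ) : ℝ → ℝ → ℝ → ℝ := fun _ x y => f ((3 * x + 4 * y) / 5)

/-- The transverse coordinate on which `ridge` depends. -/
def xi (q : Coord 4) : ℝ := (3 * q 2 + 4 * q 3) / 5

/-- The transverse coordinate orthogonal to `xi`. -/
def eta (q : Coord 4) : ℝ := (4 * q 2 - 3 * q 3) / 5

/-- The components of `dξ`. -/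
def dxi : Coord 4 := ![0, 0, 3 / 5, 4 / 5]

/-- The components of `du`. -/
def du : Coord 4 := ![1, 0, 0, 0]

/-- The components of `∂_v`. -/
def dv : Coord 4 := ![0, 1, 0, 0]

/-! ### Calculus of functions of ξ -/

theorem profile_ridge (f : ℝ → ℝ) (q : Coord 4) : profile (ridge f) q = f (xi q) := rfl

theorem ridge_contDiff {f : ℝ → ℝ} (hf : ContDiff ℝ ∞ f) :
    ContDiff ℝ ∞ (fun z : ℝ × ℝ × ℝ => ridge f z.1 z.2.1 z.2.2) := by
  unfold ridge
  exact hf.comp (by fun_prop)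

theorem xi_contDiff {n : WithTop ℕ∞} : ContDiff ℝ n xi := by
  unfold xi; fun_prop

theorem eta_contDiff {n : WithTop ℕ∞} : ContDiff ℝ n eta := by
  unfold eta; fun_prop

/-- `xi` as a continuous linear form. -/
def xiL : Coord 4 →L[ℝ] ℝ :=
  (3 / 5 : ℝ) • ContinuousLinearMap.proj 2 + (4 / 5 : ℝ) • ContinuousLinearMap.proj 3

theorem xiL_apply (q : Coord 4) : xiL q = xi q := by
  simp [xiL, xi]; ring

theorem hasFDerivAt_xi (q : Coord 4) : HasFDerivAt xi xiL q := by
  have : xi = xiL := by ext q; rw [xiL_apply]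
  rw [this]; exact xiL.hasFDerivAt

theorem hasFDerivAt_comp_xi {f : ℝ → ℝ} {f' : ℝ} {q : Coord 4} (hf : HasDerivAt f f' (xi q)) :
    HasFDerivAt (fun r => f (xi r)) (f' • xiL) q :=
  hf.comp_hasFDerivAt q (hasFDerivAt_xi q)

theorem xi_single (i : Fin 4) : xi (Pi.single i 1) = dxi i := by
  fin_cases i <;> simp [xi, dxi]

theorem pd_comp_xi {f : ℝ → ℝ} {f' : ℝ} {q : Coord 4} (hf : HasDerivAt f f' (xi q)) (i : Fin 4) :
    pd i (fun r => f (xi r)) q = f' * dxi i := by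
  rw [pd, (hasFDerivAt_comp_xi hf).fderiv]
  simp [xiL_apply, xi_single]

theorem pd_const {d : ℕ} (i : Fin d) (a : ℝ) (q : Coord d) : pd i (fun _ => a) q = 0 := by
  simp [pd]

/-! ### Connection and curvature of a plane wave with profile f(ξ) -/

namespace MetricField

theorem ip_planeWave (H : ℝ → ℝ → ℝ → ℝ) (q X Y : Coord 4) :
    (planeWave H).ip q X Y = 2 * profile H q * X 0 * Y 0 - X 0 * Y 1 - X 1 * Y 0
      + X 2 * Y 2 + X 3 * Y 3 := by
  simp [ip, planeWave, Fin.sum_univ_four]; ring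

theorem det_planeWave (H : ℝ → ℝ → ℝ → ℝ) (q : Coord 4) : (planeWave H q).det = -1 := by
  simp [planeWave, Matrix.det_succ_row_zero, Fin.sum_univ_succ, Fin.succAbove]

theorem inv_planeWave (H : ℝ → ℝ → ℝ → ℝ) (q : Coord 4) :
    (planeWave H q)⁻¹ = !![0, -1, 0, 0; -1, -(2 * profile H q), 0, 0; 0, 0, 1, 0; 0, 0, 0, 1] := by
  apply Matrix.inv_eq_right_inv
  ext i j
  fin_cases i <;> fin_cases j <;> simp [planeWave, Matrix.mul_apply, Fin.sum_univ_four]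

theorem vol_planeWave (H : ℝ → ℝ → ℝ → ℝ) : (planeWave H).vol = volume := by
  simp [vol, det_planeWave]

theorem isSmooth_planeWave_ridge {f : ℝ → ℝ} (hf : ContDiff ℝ ∞ f) :
    (planeWave (ridge f)).IsSmooth := by
  intro i j
  have : ContDiff ℝ ∞ (fun q => 2 * profile (ridge f) q) :=
    contDiff_const.mul (hf.comp xi_contDiff)
  fin_cases i <;> fin_cases j <;> first | exact this | exact contDiff_const

theorem isLorentzian_planeWave_ridge {f : ℝ → ℝ} (hf : ContDiff ℝ ∞ f) :
    IsLorentzian (m := 3) (planeWave (ridge f)) := by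
  refine ⟨isSmooth_planeWave_ridge hf, fun q => ?_⟩
  -- The columns are the orthonormal frame ∂_u + (H ± 1/2)∂_v, ∂_x, ∂_y; the plus sign gives the
  -- timelike vector.
  refine ⟨!![1, 1, 0, 0; profile (ridge f) q + 1 / 2, profile (ridge f) q - 1 / 2, 0, 0;
    0, 0, 1, 0; 0, 0, 0, 1], ?_, ?_⟩
  · rw [isUnit_iff_ne_zero]
    simp [Matrix.det_succ_row_zero, Fin.sum_univ_succ, Fin.succAbove]
    ring_nf
    norm_num
  · ext i j
    fin_cases i <;> fin_cases j <;>
      simp [planeWave, Matrix.mul_apply, Fin.sum_univ_four] <;> ring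

variable {f f' f'' : ℝ → ℝ}

theorem pd_planeWave_ridge (hf : ∀ z, HasDerivAt f (f' z) z) (q : Coord 4) (i l j : Fin 4) :
    pd i (fun r => planeWave (ridge f) r l j) q = 2 * f' (xi q) * dxi i * du l * du j := by
  have h : pd i (fun r => 2 * f (xi r)) q = 2 * f' (xi q) * dxi i :=
    pd_comp_xi (f := fun z => 2 * f z) ((hf _).const_mul 2) i
  fin_cases l <;> fin_cases j <;> simp [planeWave, profile_ridge, du, pd_const, h]

/-- The Christoffel symbols of `planeWave (ridge f)`, up to the factor `-f'(ξ)`. -/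
def ridgeConn (k i j : Fin 4) : ℝ :=
  dxi k * du i * du j + dv k * (du i * dxi j + du j * dxi i)

theorem christoffel_planeWave_ridge (hf : ∀ z, HasDerivAt f (f' z) z) (q : Coord 4)
    (k i j : Fin 4) :
    (planeWave (ridge f)).christoffel q k i j = -(f' (xi q) * ridgeConn k i j) := by
  simp only [christoffel, pd_planeWave_ridge hf, inv_planeWave, Fin.sum_univ_four, ridgeConn]
  fin_cases k <;> simp [dxi, du, dv] <;> ring

theorem christoffelVec_planeWave_ridge (hf : ∀ z, HasDerivAt f (f' z) z) (q V W : Coord 4)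
    (k : Fin 4) : (planeWave (ridge f)).christoffelVec q V W k =
      -(f' (xi q) * (dxi k * (V 0 * W 0) + dv k * (V 0 * xi W + W 0 * xi V))) := by
  simp only [christoffelVec, christoffel_planeWave_ridge hf, ridgeConn, Fin.sum_univ_four]
  generalize dxi k = e
  simp [dxi, du, xi]
  ring

/-- The terms quadratic in the connection cancel, so the curvature is linear in f''. -/
theorem riemann_planeWave_ridge (hf : ∀ z, HasDerivAt f (f' z) z)
    (hf' : ∀ z, HasDerivAt f' (f'' z) z) (q : Coord 4) (l k i j : Fin 4) :
    (planeWave (ridge f)).riemann q l k i j =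
      -(f'' (xi q) * (dxi i * ridgeConn l j k - dxi j * ridgeConn l i k)) := by
  have h (i l j k : Fin 4) : pd i (fun r => (planeWave (ridge f)).christoffel r l j k) q =
      -(f'' (xi q) * dxi i * ridgeConn l j k) := by
    have : (fun r => (planeWave (ridge f)).christoffel r l j k) =
        fun r => (fun z => -(f' z * ridgeConn l j k)) (xi r) := by
      ext r; rw [christoffel_planeWave_ridge hf]
    have h1 : HasDerivAt (fun z => -(f' z * ridgeConn l j k)) (-(f'' (xi q) * ridgeConn l j k))
      (xi q) := ((hf' (xi q)).mul_const (ridgeConn l j k)).fun_neg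
    rw [this, pd_comp_xi h1]
    ring
  -- The contraction is symmetric in `i` and `j`, hence drops out after antisymmetrization.
  have hG (i j : Fin 4) : ∑ m, ridgeConn l i m * ridgeConn m j k = dv l * du i * du j * du k := by
    simp only [Fin.sum_univ_four, ridgeConn]
    simp [dxi, du, dv]
    ring
  have hs : ∑ m, ((planeWave (ridge f)).christoffel q l i m *
      (planeWave (ridge f)).christoffel q m j k - (planeWave (ridge f)).christoffel q l j m *
      (planeWave (ridge f)).christoffel q m i k) = 0 := by
    have (m : Fin 4) : (planeWave (ridge f)).christoffel q l i m *
      (planeWave (ridge f)).christoffel q m j k - (planeWave (ridge f)).christoffel q l j m *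
      (planeWave (ridge f)).christoffel q m i k = f' (xi q) ^ 2 *
        (ridgeConn l i m * ridgeConn m j k) - f' (xi q) ^ 2 *
        (ridgeConn l j m * ridgeConn m i k) := by
      simp only [christoffel_planeWave_ridge hf]; ring
    simp only [this, Finset.sum_sub_distrib, ← Finset.mul_sum, hG]
    ring
  rw [riemann, h, h, hs]
  ring

theorem curvatureForm_planeWave_ridge (hf : ∀ z, HasDerivAt f (f' z) z)
    (hf' : ∀ z, HasDerivAt f' (f'' z) z) (q X Y : Coord 4) :
    (planeWave (ridge f)).curvatureForm q X Y =
      -(f'' (xi q) * (X 0 * xi Y - Y 0 * xi X) ^ 2) := by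
  have hc (l : Fin 4) : (planeWave (ridge f)).curvature q X Y Y l = -(f'' (xi q) *
      (xi X * Y 0 - xi Y * X 0) * (dxi l * Y 0 + dv l * xi Y)) := by
    have (i j k : Fin 4) : (planeWave (ridge f)).riemann q l k i j * X i * Y j * Y k =
        -(f'' (xi q)) * (dxi l * ((dxi i * X i) * (du j * Y j) - (du i * X i) * (dxi j * Y j)) *
        (du k * Y k) + dv l * ((dxi i * X i) * (du j * Y j) - (du i * X i) * (dxi j * Y j)) *
        (dxi k * Y k)) := by
      rw [riemann_planeWave_ridge hf hf', ridgeConn, ridgeConn]; ring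
    simp only [curvature, this]
    simp only [Fin.sum_univ_four]
    simp [dxi, du, xi]
    ring
  rw [curvatureForm, ip_planeWave]
  simp only [hc]
  simp [dxi, dv, xi]
  ring

theorem curvatureForm_planeWave_ridge_nonpos (hf : ∀ z, HasDerivAt f (f' z) z)
    (hf' : ∀ z, HasDerivAt f' (f'' z) z) (h0 : ∀ z, 0 ≤ f'' z) (q X Y : Coord 4) :
    (planeWave (ridge f)).curvatureForm q X Y ≤ 0 := by
  rw [curvatureForm_planeWave_ridge hf hf']
  have := h0 (xi q)
  nlinarith [mul_nonneg this (sq_nonneg (X 0 * xi Y - Y 0 * xi X))]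

end MetricField

theorem pd_pd_profile_ridge {f f' f'' : ℝ → ℝ} (hf : ∀ z, HasDerivAt f (f' z) z)
    (hf' : ∀ z, HasDerivAt f' (f'' z) z) (i j : Fin 4) (q : Coord 4) :
    pd i (pd j (profile (ridge f))) q = f'' (xi q) * dxi i * dxi j := by
  have : pd j (profile (ridge f)) = fun r => (fun z => f' z * dxi j) (xi r) := by
    ext r
    exact pd_comp_xi (hf _) j
  rw [this, pd_comp_xi ((hf' _).mul_const _)]
  ring

theorem transverseHessian_ridge {f f' f'' : ℝ → ℝ} (hf : ∀ z, HasDerivAt f (f' z) z)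
    (hf' : ∀ z, HasDerivAt f' (f'' z) z) (q : Coord 4) :
    transverseHessian (ridge f) q =
      f'' (xi q) • Matrix.vecMulVec ![3 / 5, 4 / 5] (star ![3 / 5, 4 / 5]) := by
  ext i j
  fin_cases i <;> fin_cases j <;>
    simp [transverseHessian, pd_pd_profile_ridge hf hf', dxi] <;> ring

theorem transverseHessian_ridge_posSemidef {f f' f'' : ℝ → ℝ} (hf : ∀ z, HasDerivAt f (f' z) z)
    (hf' : ∀ z, HasDerivAt f' (f'' z) z) (h0 : ∀ z, 0 ≤ f'' z) (q : Coord 4) :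
    (transverseHessian (ridge f) q).PosSemidef := by
  rw [transverseHessian_ridge hf hf']
  exact (Matrix.posSemidef_vecMulVec_self_star _).smul (h0 _)

/-! ### Newton's equation with bounded force -/

open scoped NNReal in
/-- Newton's equation `x'' = g(x)` with a bounded force is solvable on every bounded interval. -/
theorem exists_newton_Ioo {g : ℝ → ℝ} {K : ℝ≥0} (hg : LipschitzWith K g) {M : ℝ}
    (hM : ∀ x, |g x| ≤ M) (x₀ w₀ : ℝ) {N : ℝ} (hN : 0 < N) :
    ∃ z : ℝ → ℝ × ℝ, z 0 = (x₀, w₀) ∧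
      ∀ s ∈ Ioo (-N) N, HasDerivAt z ((z s).2, g (z s).1) s := by
  have hM0 : 0 ≤ M := (abs_nonneg _).trans (hM 0)
  -- The velocity is rescaled by 2N. This halves the growth of the first component, so on a ball of
  -- radius `a` the field has norm at most a/N and the solution cannot leave the ball within time N.
  set v : ℝ × ℝ → ℝ × ℝ := fun z => ((2 * N)⁻¹ • z.2, (2 * N) • g z.1) with hv
  have hlip : ∃ K', LipschitzWith K' v :=
    ⟨_, ((lipschitzWith_smul _).comp LipschitzWith.prod_snd).prodMk
      ((lipschitzWith_smul _).comp (hg.comp LipschitzWith.prod_fst))⟩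
  obtain ⟨K', hK'⟩ := hlip
  obtain ⟨a, ha⟩ : ∃ a : ℝ≥0, (a : ℝ) = 2 * N * |w₀| + 2 * N ^ 2 * M :=
    ⟨⟨2 * N * |w₀| + 2 * N ^ 2 * M, by positivity⟩, rfl⟩
  obtain ⟨L, hL⟩ : ∃ L : ℝ≥0, (L : ℝ) = a / N := ⟨⟨a / N, by positivity⟩, rfl⟩
  have hpl : IsPicardLindelof (fun _ => v) (tmin := -N) (tmax := N)
      ⟨0, by simp [hN.le], hN.le⟩ (x₀, 2 * N * w₀) a 0 L K' := by
    apply IsPicardLindelof.of_time_independent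
    · intro z hz
      have h2 : |z.2 - 2 * N * w₀| ≤ a := by
        have := (norm_snd_le (z - (x₀, 2 * N * w₀))).trans (mem_closedBall_iff_norm.mp hz)
        simpa using this
      rw [hL, Prod.norm_def, sup_le_iff]
      constructor
      · simp only [hv, norm_smul, Real.norm_eq_abs, abs_inv, abs_of_pos (by positivity : 0 < 2 * N)]
        rw [inv_mul_le_iff₀ (by positivity)]
        have h3 : |z.2| ≤ a + 2 * N * |w₀| := by
          have := abs_add_le (z.2 - 2 * N * w₀) (2 * N * w₀)
          rw [sub_add_cancel, abs_mul (2 * N), abs_of_pos (by positivity : 0 < 2 * N)] at this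
          linarith
        have h4 : 2 * N * (a / N) = 2 * (a : ℝ) := by field_simp
        have : 0 ≤ 2 * N ^ 2 * M := by positivity
        linarith
      · simp only [hv, norm_smul, Real.norm_eq_abs, abs_of_pos (by positivity : 0 < 2 * N)]
        rw [le_div_iff₀ hN, ha]
        have h5 := mul_le_mul_of_nonneg_left (hM z.1) (by positivity : 0 ≤ 2 * N * N)
        have : 0 ≤ 2 * N * |w₀| := by positivity
        nlinarith
    · exact hK'.lipschitzOnWith
    · simp [hL, hN.ne']
  obtain ⟨α, hα0, hα⟩ := hpl.exists_eq_forall_mem_Icc_hasDerivWithinAt₀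
  refine ⟨fun s => ((α s).1, (2 * N)⁻¹ * (α s).2), ?_, fun s hs => ?_⟩
  · simp only at hα0
    simp only [hα0, Prod.mk.injEq, true_and]
    field_simp
  · have h := (hα s (Ioo_subset_Icc_self hs)).hasDerivAt (Icc_mem_nhds hs.1 hs.2)
    have h1 : HasDerivAt (fun s => (α s).1) (v (α s)).1 s := h.fst
    have h2 : HasDerivAt (fun s => (α s).2) (v (α s)).2 s := h.snd
    refine (h1.prodMk (h2.const_mul (2 * N)⁻¹)).congr_deriv ?_
    simp only [hv, smul_eq_mul, Prod.mk.injEq, true_and]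
    field_simp

open scoped NNReal in
/-- Newton's equation `x'' = g(x)` with a bounded Lipschitz force is solvable for all times. -/
theorem exists_newton {g : ℝ → ℝ} {K : ℝ≥0} (hg : LipschitzWith K g) {M : ℝ}
    (hM : ∀ x, |g x| ≤ M) (x₀ w₀ : ℝ) :
    ∃ x w : ℝ → ℝ, x 0 = x₀ ∧ w 0 = w₀ ∧
      ∀ s, HasDerivAt x (w s) s ∧ HasDerivAt w (g (x s)) s := by
  choose! z hz0 hz using fun (N : ℝ) (hN : 0 < N) => exists_newton_Ioo hg hM x₀ w₀ hN
  have hlip : ∃ K', LipschitzWith K' (fun y : ℝ × ℝ => (y.2, g y.1)) :=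
    ⟨_, LipschitzWith.prod_snd.prodMk (hg.comp LipschitzWith.prod_fst)⟩
  obtain ⟨K', hK'⟩ := hlip
  have huniq {N N' : ℝ} (hN : 0 < N) (hNN' : N ≤ N') : EqOn (z N) (z N') (Ioo (-N) N) :=
    ODE_solution_unique_of_mem_Ioo (v := fun _ y => (y.2, g y.1)) (s := fun _ => univ)
      (fun _ _ => hK'.lipschitzOnWith) (t₀ := 0) ⟨by linarith, hN⟩
      (fun s hs => ⟨hz N hN s hs, mem_univ _⟩)
      (fun s hs => ⟨hz N' (hN.trans_le hNN') s ⟨by linarith [hs.1], by linarith [hs.2]⟩,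
        mem_univ _⟩) (by rw [hz0 N hN, hz0 N' (hN.trans_le hNN')])
  -- The solutions on (−N, N) agree by uniqueness; at time s the one with N = |s| + 1 is used.
  have hglue (s : ℝ) : HasDerivAt (fun s => z (|s| + 1) s)
      ((z (|s| + 1) s).2, g (z (|s| + 1) s).1) s := by
    have hs : s ∈ Ioo (-(|s| + 1)) (|s| + 1) := abs_lt.mp (lt_add_one _)
    have hpos : 0 < |s| + 1 := by positivity
    refine (hz _ hpos s hs).congr_of_eventuallyEq ?_
    filter_upwards [isOpen_Ioo.mem_nhds hs] with r hr
    rcases le_total (|r| + 1) (|s| + 1) with h | h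
    · exact huniq (by positivity) h (abs_lt.mp (lt_add_one _))
    · exact (huniq hpos h hr).symm
  refine ⟨fun s => (z (|s| + 1) s).1, fun s => (z (|s| + 1) s).2, ?_, ?_,
    fun s => ⟨(hglue s).fst, (hglue s).snd⟩⟩
  · simp [hz0 1 one_pos]
  · simp [hz0 1 one_pos]

/-! ### Geodesics in the coordinates u, v, ξ, η -/

/-- The point with coordinates `u, v, ξ, η`. -/
def ofXiEta (u v x e : ℝ) : Coord 4 := ![u, v, (3 * x + 4 * e) / 5, (4 * x - 3 * e) / 5]

theorem xi_ofXiEta (u v x e : ℝ) : xi (ofXiEta u v x e) = x := by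
  simp [xi, ofXiEta]; ring

theorem eta_ofXiEta (u v x e : ℝ) : eta (ofXiEta u v x e) = e := by
  simp [eta, ofXiEta]; ring

theorem ofXiEta_self (q : Coord 4) : ofXiEta (q 0) (q 1) (xi q) (eta q) = q := by
  ext i
  fin_cases i <;> simp [xi, eta, ofXiEta] <;> ring

theorem hasDerivWithinAt_ofXiEta {u v x e : ℝ → ℝ} {u' v' x' e' s : ℝ} {J : Set ℝ}
    (hu : HasDerivWithinAt u u' J s) (hv : HasDerivWithinAt v v' J s)
    (hx : HasDerivWithinAt x x' J s) (he : HasDerivWithinAt e e' J s) :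
    HasDerivWithinAt (fun s => ofXiEta (u s) (v s) (x s) (e s)) (ofXiEta u' v' x' e') J s := by
  rw [hasDerivWithinAt_pi]
  intro i
  fin_cases i
  · exact hu
  · exact hv
  · exact ((hx.const_mul 3).add (he.const_mul 4)).div_const 5
  · exact ((hx.const_mul 4).sub (he.const_mul 3)).div_const 5

namespace MetricField

variable {f f' f'' : ℝ → ℝ}

theorem ip_planeWave_ridge (q X Y : Coord 4) : (planeWave (ridge f)).ip q X Y =
    2 * f (xi q) * X 0 * Y 0 - X 0 * Y 1 - X 1 * Y 0 + xi X * xi Y + eta X * eta Y := by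
  rw [ip_planeWave, profile_ridge, xi, xi, xi, eta, eta]
  ring

/-- The geodesic equation of `planeWave (ridge f)` in the coordinates `u, v, ξ, η`. -/
theorem isGeodesicOn_ofXiEta (hf : ∀ z, HasDerivAt f (f' z) z)
    {u v x e u' v' x' e' : ℝ → ℝ} {J : Set ℝ}
    (hu : ∀ s ∈ J, HasDerivWithinAt u (u' s) J s) (hv : ∀ s ∈ J, HasDerivWithinAt v (v' s) J s)
    (hx : ∀ s ∈ J, HasDerivWithinAt x (x' s) J s) (he : ∀ s ∈ J, HasDerivWithinAt e (e' s) J s)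
    (hu' : ∀ s ∈ J, HasDerivWithinAt u' 0 J s)
    (hv' : ∀ s ∈ J, HasDerivWithinAt v' (2 * f' (x s) * u' s * x' s) J s)
    (hx' : ∀ s ∈ J, HasDerivWithinAt x' (f' (x s) * u' s ^ 2) J s)
    (he' : ∀ s ∈ J, HasDerivWithinAt e' 0 J s) :
    (planeWave (ridge f)).IsGeodesicOn (fun s => ofXiEta (u s) (v s) (x s) (e s))
      (fun s => ofXiEta (u' s) (v' s) (x' s) (e' s)) J := by
  refine fun s hs => ⟨hasDerivWithinAt_ofXiEta (hu s hs) (hv s hs) (hx s hs) (he s hs), ?_⟩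
  refine (hasDerivWithinAt_ofXiEta (hu' s hs) (hv' s hs) (hx' s hs) (he' s hs)).congr_deriv ?_
  ext i
  rw [Pi.neg_apply, christoffelVec_planeWave_ridge hf, xi_ofXiEta, xi_ofXiEta]
  fin_cases i <;> simp [ofXiEta, dxi, dv] <;> ring

-- Along a geodesic u and η are affine, ξ obeys Newton's equation with force (u')² f'(ξ), and v is
-- found by quadrature. A bounded Lipschitz f' therefore suffices.
open scoped NNReal in
theorem isGeodesicallyComplete_planeWave_ridge (hf : ∀ z, HasDerivAt f (f' z) z) {K : ℝ≥0}
    (hlip : LipschitzWith K f') {M : ℝ} (hM : ∀ z, |f' z| ≤ M) :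
    (planeWave (ridge f)).IsGeodesicallyComplete := by
  intro q W
  obtain ⟨x, x', hx0, hx'0, hx⟩ := exists_newton
    (LipschitzWith.comp (lipschitzWith_smul (W 0 ^ 2)) hlip) (M := W 0 ^ 2 * M)
    (fun z => by
      simp only [Function.comp, smul_eq_mul, abs_mul, abs_of_nonneg (sq_nonneg (W 0))]
      exact mul_le_mul_of_nonneg_left (hM z) (sq_nonneg _)) (xi q) (xi W)
  -- First integral of the v-equation: v' − 2u' f(ξ) is constant.
  have hfx (s : ℝ) : HasDerivAt (fun s => 2 * W 0 * (f (x s) - f (xi q)) + W 1)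
      (2 * f' (x s) * W 0 * x' s) s := by
    refine (((((hf (x s)).comp s (hx s).1).sub_const (f (xi q))).const_mul (2 * W 0)).add_const
      (W 1)).congr_deriv ?_
    ring
  have hcont : Continuous (fun s => 2 * W 0 * (f (x s) - f (xi q)) + W 1) :=
    continuous_iff_continuousAt.mpr fun s => (hfx s).continuousAt
  refine ⟨fun s => ofXiEta (q 0 + s * W 0)
      (q 1 + ∫ r in (0 : ℝ)..s, (2 * W 0 * (f (x r) - f (xi q)) + W 1)) (x s) (eta q + s * eta W),
    fun s => ofXiEta (W 0) (2 * W 0 * (f (x s) - f (xi q)) + W 1) (x' s) (eta W),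
    isGeodesicOn_ofXiEta hf ?_ ?_ ?_ ?_ ?_ ?_ ?_ ?_, ?_, ?_⟩
  · intro s _
    simpa using ((hasDerivWithinAt_id s univ).mul_const (W 0)).const_add (q 0)
  · intro s _
    exact ((hcont.integral_hasStrictDerivAt 0 s).hasDerivAt.const_add _).hasDerivWithinAt
  · exact fun s _ => (hx s).1.hasDerivWithinAt
  · intro s _
    simpa using ((hasDerivWithinAt_id s univ).mul_const (eta W)).const_add (eta q)
  · exact fun s _ => hasDerivWithinAt_const _ _ _
  · exact fun s _ => (hfx s).hasDerivWithinAt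
  · intro s _
    refine ((hx s).2.hasDerivWithinAt).congr_deriv ?_
    simp [mul_comm]
  · exact fun s _ => hasDerivWithinAt_const _ _ _
  · simp [hx0, ofXiEta_self]
  · simp [hx0, hx'0, ofXiEta_self]

end MetricField

/-! ### Scale factors and the time function with constant lapse -/

/-- Data of a plane wave in Rosen-type coordinates: `P` is the scale factor, `X' = P`, `S = X⁻¹`
and `Q' = P²`. -/
structure RosenProfile where
  P : ℝ → ℝ
  P' : ℝ → ℝ
  P'' : ℝ → ℝ
  X : ℝ → ℝ
  S : ℝ → ℝ
  Q : ℝ → ℝ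
  one_le : ∀ s, 1 ≤ P s
  hasDerivAt_P : ∀ s, HasDerivAt P (P' s) s
  hasDerivAt_P' : ∀ s, HasDerivAt P' (P'' s) s
  hasDerivAt_X : ∀ s, HasDerivAt X (P s) s
  hasDerivAt_Q : ∀ s, HasDerivAt Q (P s ^ 2) s
  X_S : ∀ z, X (S z) = z
  S_X : ∀ s, S (X s) = s
  contDiff_P : ContDiff ℝ ∞ P
  contDiff_X : ContDiff ℝ ∞ X
  contDiff_S : ContDiff ℝ ∞ S
  contDiff_Q : ContDiff ℝ ∞ Q

theorem fderiv_apply_eq_of_hasDerivAt {d : ℕ} {E : Type*} [NormedAddCommGroup E] [NormedSpace ℝ E]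
    {F : Coord d → E} {c W : Coord d} {D : E} (hF : DifferentiableAt ℝ F c)
    (h : HasDerivAt (fun s : ℝ => F (c + s • W)) D 0) : fderiv ℝ F c W = D := by
  have h1 : HasDerivAt (fun s : ℝ => c + s • W) W 0 := by
    simpa using ((hasDerivAt_id (0 : ℝ)).smul_const W).const_add c
  have h2 : HasFDerivAt F (fderiv ℝ F c) (c + (0 : ℝ) • W) := by simpa using hF.hasFDerivAt
  exact (h2.comp_hasDerivAt 0 h1).unique h

namespace RosenProfile

variable (F : RosenProfile)

theorem P_pos (s : ℝ) : 0 < F.P s := one_pos.trans_le (F.one_le s)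

theorem hasDerivAt_S (z : ℝ) : HasDerivAt F.S (F.P (F.S z))⁻¹ z :=
  (F.hasDerivAt_X (F.S z)).of_local_left_inverse F.contDiff_S.continuous.continuousAt
    (F.P_pos _).ne' (Eventually.of_forall F.X_S)

/-- The potential of the plane wave. -/
def f (z : ℝ) : ℝ := (F.P (F.S z) ^ 2 - 1) / 2

/-- The derivative of the potential. -/
def f' (z : ℝ) : ℝ := F.P' (F.S z)

/-- The second derivative of the potential. -/
def f'' (z : ℝ) : ℝ := F.P'' (F.S z) / F.P (F.S z)

theorem contDiff_f : ContDiff ℝ ∞ F.f :=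
  (((F.contDiff_P.comp F.contDiff_S).pow 2).sub contDiff_const).div_const 2

theorem hasDerivAt_PS (z : ℝ) :
    HasDerivAt (fun z => F.P (F.S z)) (F.P' (F.S z) / F.P (F.S z)) z :=
  (F.hasDerivAt_P _).comp z (F.hasDerivAt_S z)

theorem hasDerivAt_QS (z : ℝ) : HasDerivAt (fun z => F.Q (F.S z)) (F.P (F.S z)) z := by
  refine ((F.hasDerivAt_Q _).comp z (F.hasDerivAt_S z)).congr_deriv ?_
  have := (F.P_pos (F.S z)).ne'
  field_simp

theorem hasDerivAt_f (z : ℝ) : HasDerivAt F.f (F.f' z) z := by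
  refine ((((F.hasDerivAt_PS z).pow 2).sub_const 1).div_const 2).congr_deriv ?_
  have := (F.P_pos (F.S z)).ne'
  simp [f']
  field_simp

theorem hasDerivAt_f' (z : ℝ) : HasDerivAt F.f' (F.f'' z) z :=
  (F.hasDerivAt_P' _).comp z (F.hasDerivAt_S z)

/-- The plane-wave metric with potential `f`. -/
def metric : MetricField 4 := planeWave (ridge F.f)

/-- The value of the scale factor at a spacetime point. -/
def scale (q : Coord 4) : ℝ := F.P (F.S (xi q))

theorem scale_pos (q : Coord 4) : 0 < F.scale q := F.P_pos _

/-- The form `n dτ` for the time function with lapse `n`. -/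
def timeForm (q V : Coord 4) : ℝ := V 0 + V 1 - F.scale q * xi V

/-- The time function with constant lapse `n`. -/
def time (n : ℝ) (q : Coord 4) : ℝ := (q 0 + q 1 - F.Q (F.S (xi q))) / n

theorem contDiff_time (n : ℝ) : ContDiff ℝ ∞ (F.time n) := by
  have := F.contDiff_Q.comp (F.contDiff_S.comp (xi_contDiff (n := ∞)))
  unfold time
  exact ContDiff.div_const (ContDiff.sub (by fun_prop) this) n

theorem fderiv_time (n : ℝ) (q V : Coord 4) :
    fderiv ℝ (F.time n) q V = F.timeForm q V / n := by
  have h0 : HasFDerivAt (fun q : Coord 4 => q 0)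
    (ContinuousLinearMap.proj (R := ℝ) (φ := fun _ : Fin 4 => ℝ) 0) q :=
    (ContinuousLinearMap.proj (R := ℝ) (φ := fun _ : Fin 4 => ℝ) 0).hasFDerivAt
  have h1 : HasFDerivAt (fun q : Coord 4 => q 1)
    (ContinuousLinearMap.proj (R := ℝ) (φ := fun _ : Fin 4 => ℝ) 1) q :=
    (ContinuousLinearMap.proj (R := ℝ) (φ := fun _ : Fin 4 => ℝ) 1).hasFDerivAt
  have h2 := hasFDerivAt_comp_xi (q := q) (F.hasDerivAt_QS _)
  have h := ((h0.add h1).sub h2).mul_const n⁻¹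
  have e : F.time n = fun q : Coord 4 => (q 0 + q 1 - F.Q (F.S (xi q))) * n⁻¹ := by
    ext q; rw [time, div_eq_mul_inv]
  rw [e]
  refine (congrFun (congrArg DFunLike.coe h.fderiv) V).trans ?_
  simp [timeForm, scale, xiL_apply, div_eq_mul_inv, mul_comm]

theorem pd_time (n : ℝ) (q : Coord 4) (i : Fin 4) :
    pd i (F.time n) q = (du i + dv i - F.scale q * dxi i) / n := by
  rw [pd, fderiv_time, timeForm, xi_single]
  fin_cases i <;> simp [du, dv]

theorem profile_eq (q : Coord 4) : 2 * profile (ridge F.f) q = F.scale q ^ 2 - 1 := by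
  rw [profile_ridge, f, scale]; ring

/-- Eikonal equation: n² g(dτ, dτ) = −2 − 2f + P², and P² = 1 + 2f. -/
theorem gradSq_time {n : ℝ} (hn : n ≠ 0) (q : Coord 4) :
    F.metric.gradSq (F.time n) q = -(1 / n ^ 2) := by
  simp only [MetricField.gradSq, metric, MetricField.inv_planeWave, F.profile_eq, pd_time,
    Fin.sum_univ_four]
  simp [du, dv, dxi]
  field_simp
  ring

theorem lapse_time {n : ℝ} (hn : 0 < n) (q : Coord 4) : F.metric.lapse (F.time n) q = n := by
  rw [MetricField.lapse, gradSq_time F hn.ne', neg_neg, Real.sqrt_div zero_le_one,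
    Real.sqrt_sq hn.le, Real.sqrt_one, one_div, inv_inv]

theorem unitNormal_time {n : ℝ} (hn : 0 < n) (q : Coord 4) :
    F.metric.unitNormal (F.time n) q = ofXiEta 1 (F.scale q ^ 2) (F.scale q) 0 := by
  ext i
  rw [MetricField.unitNormal, lapse_time F hn]
  simp only [metric, MetricField.inv_planeWave, F.profile_eq, pd_time, Fin.sum_univ_four]
  fin_cases i <;> simp [du, dv, dxi, ofXiEta] <;> field_simp <;> ring

theorem ip_metric (q V W : Coord 4) : F.metric.ip q V W = (F.scale q ^ 2 - 1) * V 0 * W 0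
    - V 0 * W 1 - V 1 * W 0 + xi V * xi W + eta V * eta W := by
  rw [metric, MetricField.ip_planeWave_ridge, f, scale]; ring

theorem ip_unitNormal {n : ℝ} (hn : 0 < n) (q V : Coord 4) :
    F.metric.ip q (F.metric.unitNormal (F.time n) q) V = -F.timeForm q V := by
  rw [unitNormal_time F hn, ip_metric, xi_ofXiEta, eta_ofXiEta, timeForm]
  simp [ofXiEta]; ring

/-- The metric in an orthogonal coframe. -/
theorem ip_self (q V : Coord 4) : F.metric.ip q V V =
    (F.scale q * V 0 - xi V) ^ 2 + (V 0 - F.timeForm q V) ^ 2 + eta V ^ 2 - F.timeForm q V ^ 2 := by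
  rw [ip_metric, timeForm]; ring

theorem refSq_time {n : ℝ} (hn : 0 < n) (q V : Coord 4) : F.metric.refSq (F.time n) q V =
    (F.scale q * V 0 - xi V) ^ 2 + (V 0 - F.timeForm q V) ^ 2 + eta V ^ 2 + F.timeForm q V ^ 2 := by
  rw [MetricField.refSq, ip_unitNormal F hn, ip_self]; ring

theorem isFutureCausal_iff {n : ℝ} (hn : 0 < n) (q V : Coord 4) :
    F.metric.IsFutureCausal (F.time n) q V ↔
      (F.scale q * V 0 - xi V) ^ 2 + (V 0 - F.timeForm q V) ^ 2 + eta V ^ 2 ≤ F.timeForm q V ^ 2 ∧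
      0 < F.timeForm q V := by
  rw [MetricField.IsFutureCausal, ip_unitNormal F hn, ip_self, neg_lt_zero, sub_nonpos]

/-- The derivative in `ξ` of the unit normal. -/
theorem pd_unitNormal_time {n : ℝ} (hn : 0 < n) (q : Coord 4) (i k : Fin 4) :
    pd i (fun r => F.metric.unitNormal (F.time n) r k) q =
      (2 * F.P' (F.S (xi q)) * dv k + F.P' (F.S (xi q)) / F.scale q * dxi k) * dxi i := by
  have e : (fun r => F.metric.unitNormal (F.time n) r k) = fun r =>
      (fun z => du k + F.P (F.S z) ^ 2 * dv k + F.P (F.S z) * dxi k) (xi r) := by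
    ext r
    rw [unitNormal_time F hn]
    fin_cases k <;> simp [du, dv, dxi, ofXiEta, scale] <;> ring
  have h : HasDerivAt (fun z => du k + F.P (F.S z) ^ 2 * dv k + F.P (F.S z) * dxi k)
      (2 * F.P' (F.S (xi q)) * dv k + F.P' (F.S (xi q)) / F.scale q * dxi k) (xi q) := by
    refine (((((F.hasDerivAt_PS (xi q)).fun_pow 2).mul_const (dv k)).const_add (du k)).add
      ((F.hasDerivAt_PS (xi q)).mul_const (dxi k))).congr_deriv ?_
    have := (F.P_pos (F.S (xi q))).ne'
    simp [scale]
    field_simp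
    simp
  rw [e, pd_comp_xi h]

/-- Along T only the summand (P db)² of the metric evolves, where P db = dξ − P du. Hence the
coefficient is 2P'/P and no second derivative of P enters. -/
theorem deformation_time {n : ℝ} (hn : 0 < n) (q : Coord 4) (i j : Fin 4) :
    F.metric.deformation (F.time n) q i j = 2 * (F.P' (F.S (xi q)) / F.scale q) *
      (F.scale q * du i - dxi i) * (F.scale q * du j - dxi j) := by
  have h := (F.scale_pos q).ne'
  have hg (k l m : Fin 4) : pd k (fun r => F.metric r l m) q =
      2 * F.P' (F.S (xi q)) * dxi k * du l * du m :=
    MetricField.pd_planeWave_ridge F.hasDerivAt_f q k l m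
  have hcomp (l m : Fin 4) : F.metric q l m =
      !![F.scale q ^ 2 - 1, -1, 0, 0; -1, 0, 0, 0; 0, 0, 1, 0; 0, 0, 0, 1] l m := by
    rw [metric, planeWave, F.profile_eq]
  simp only [MetricField.deformation, hg, pd_unitNormal_time F hn]
  simp only [Fin.sum_univ_four, unitNormal_time F hn, hcomp]
  generalize F.P' (F.S (xi q)) = D
  generalize F.scale q = s at *
  fin_cases i <;> fin_cases j <;> simp [du, dv, dxi, ofXiEta] <;> (try field_simp) <;> ring

theorem deformation_time_apply {n : ℝ} (hn : 0 < n) (q V : Coord 4) :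
    ∑ i, ∑ j, F.metric.deformation (F.time n) q i j * V i * V j =
      2 * (F.P' (F.S (xi q)) / F.scale q) * (F.scale q * V 0 - xi V) ^ 2 := by
  simp only [deformation_time F hn, Fin.sum_univ_four]
  simp [du, dxi, xi]
  ring

theorem abs_deformation_time_le {n ε : ℝ} (hn : 0 < n) (hP0 : ∀ s, 0 ≤ F.P' s)
    (hP : ∀ s, F.P' s ≤ ε) (q V : Coord 4) :
    |∑ i, ∑ j, F.metric.deformation (F.time n) q i j * V i * V j| ≤
      2 * ε * F.metric.refSq (F.time n) q V := by
  have h1 : 0 ≤ F.P' (F.S (xi q)) / F.scale q := div_nonneg (hP0 _) (F.scale_pos q).le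
  have h2 : F.P' (F.S (xi q)) / F.scale q ≤ ε :=
    (div_le_self (hP0 _) (F.one_le _)).trans (hP _)
  have hε : 0 ≤ ε := (hP0 0).trans (hP 0)
  rw [deformation_time_apply F hn, refSq_time F hn, abs_of_nonneg (by positivity)]
  have h3 : (F.scale q * V 0 - xi V) ^ 2 ≤ (F.scale q * V 0 - xi V) ^ 2 +
      (V 0 - F.timeForm q V) ^ 2 + eta V ^ 2 + F.timeForm q V ^ 2 := by
    nlinarith [sq_nonneg (V 0 - F.timeForm q V), sq_nonneg (eta V), sq_nonneg (F.timeForm q V)]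
  gcongr

/-! ### Transported coordinates -/

/-- The argument of the scale factor in transported coordinates. -/
def phase (n : ℝ) (c : Coord 4) : ℝ := c 1 + c 2 + n * c 0

/-- The transported coordinate system. -/
def chart (n : ℝ) (c : Coord 4) : Coord 4 :=
  ofXiEta (c 1 + n * c 0) (F.Q (phase n c) - c 1) (F.X (phase n c)) (c 3)

/-- The inverse of the transported coordinate system. -/
def chartInv (n : ℝ) (q : Coord 4) : Coord 4 :=
  ![F.time n q, F.Q (F.S (xi q)) - q 1, F.S (xi q) - q 0, eta q]

theorem contDiff_phase (n : ℝ) : ContDiff ℝ ∞ (phase n) := by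
  unfold phase; fun_prop

theorem contDiff_chart (n : ℝ) : ContDiff ℝ ∞ (F.chart n) := by
  have hX := F.contDiff_X.comp (contDiff_phase n)
  have hQ := F.contDiff_Q.comp (contDiff_phase n)
  simp only [Function.comp_def] at hX hQ
  rw [contDiff_pi]
  intro i
  fin_cases i <;> simp [chart, ofXiEta] <;> fun_prop

theorem contDiff_chartInv (n : ℝ) : ContDiff ℝ ∞ (F.chartInv n) := by
  have hS := F.contDiff_S.comp (xi_contDiff (n := ∞))
  have hQ := F.contDiff_Q.comp hS
  have ht := F.contDiff_time n
  have he := eta_contDiff (n := ∞)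
  simp only [Function.comp_def] at hS hQ
  rw [contDiff_pi]
  intro i
  fin_cases i <;> simp [chartInv] <;> fun_prop

theorem xi_chart (n : ℝ) (c : Coord 4) : xi (F.chart n c) = F.X (phase n c) := xi_ofXiEta ..

theorem scale_chart (n : ℝ) (c : Coord 4) : F.scale (F.chart n c) = F.P (phase n c) := by
  rw [scale, xi_chart, S_X]

theorem time_chart {n : ℝ} (hn : n ≠ 0) (c : Coord 4) : F.time n (F.chart n c) = c 0 := by
  rw [time, xi_chart, S_X]
  simp [chart, ofXiEta]
  field_simp
  ring

theorem chartInv_chart {n : ℝ} (hn : n ≠ 0) (c : Coord 4) : F.chartInv n (F.chart n c) = c := by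
  ext i
  rw [chartInv, time_chart F hn, xi_chart, S_X]
  fin_cases i
  · simp
  · simp [chart, ofXiEta]
  · simp [chart, ofXiEta, phase]
  · simp [chart, eta_ofXiEta]

theorem phase_chartInv {n : ℝ} (hn : n ≠ 0) (q : Coord 4) :
    phase n (F.chartInv n q) = F.S (xi q) := by
  simp [phase, chartInv, time]
  field_simp
  ring

theorem chart_chartInv {n : ℝ} (hn : n ≠ 0) (q : Coord 4) : F.chart n (F.chartInv n q) = q := by
  rw [chart, phase_chartInv F hn, X_S]
  refine Eq.trans ?_ (ofXiEta_self q)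
  congr 1
  · simp [chartInv, time]
    field_simp
    ring
  · simp [chartInv]

theorem fderiv_chart (n : ℝ) (c W : Coord 4) : fderiv ℝ (F.chart n) c W =
    ofXiEta (W 1 + n * W 0) (F.P (phase n c) ^ 2 * phase n W - W 1)
      (F.P (phase n c) * phase n W) (W 3) := by
  apply fderiv_apply_eq_of_hasDerivAt ((F.contDiff_chart n).differentiable (by simp) c)
  have hlin (i : Fin 4) : HasDerivAt (fun s : ℝ => c i + s * W i) (W i) 0 := by
    simpa using ((hasDerivAt_id (0 : ℝ)).mul_const (W i)).const_add (c i)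
  have hph : HasDerivAt (fun s : ℝ => phase n (c + s • W)) (phase n W) 0 := by
    simpa [phase] using ((hlin 1).fun_add (hlin 2)).fun_add ((hlin 0).const_mul n)
  have hph0 : phase n (c + (0 : ℝ) • W) = phase n c := by simp
  have hX := (F.hasDerivAt_X (phase n (c + (0 : ℝ) • W))).comp 0 hph
  have hQ := (F.hasDerivAt_Q (phase n (c + (0 : ℝ) • W))).comp 0 hph
  rw [hph0] at hX hQ
  rw [← hasDerivWithinAt_univ] at hX hQ ⊢
  exact hasDerivWithinAt_ofXiEta ((hlin 1).add ((hlin 0).const_mul n)).hasDerivWithinAt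
    (hQ.sub (hlin 1).hasDerivWithinAt) hX (hlin 3).hasDerivWithinAt

theorem timeForm_fderiv_chart (n : ℝ) (c W : Coord 4) :
    F.timeForm (F.chart n c) (fderiv ℝ (F.chart n) c W) = n * W 0 := by
  rw [fderiv_chart, timeForm, scale_chart, xi_ofXiEta]
  simp [ofXiEta, phase]; ring

/-- The Rosen form of the metric, from which the slice geometry and the causal segments are read
off. -/
theorem ip_fderiv_chart (n : ℝ) (c W Z : Coord 4) :
    F.metric.ip (F.chart n c) (fderiv ℝ (F.chart n) c W) (fderiv ℝ (F.chart n) c Z) =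
      -(n ^ 2 * W 0 * Z 0) + W 1 * Z 1 + F.P (phase n c) ^ 2 * W 2 * Z 2 + W 3 * Z 3 := by
  rw [ip_metric, fderiv_chart, fderiv_chart, scale_chart, xi_ofXiEta, xi_ofXiEta, eta_ofXiEta,
    eta_ofXiEta]
  simp [ofXiEta, phase]; ring

theorem isTransported {n : ℝ} (hn : 0 < n) :
    MetricField.IsTransported (m := 3) F.metric (F.time n) (F.chart n) where
  smooth_time := F.contDiff_time n
  timelike q := by rw [gradSq_time F hn.ne', neg_lt_zero]; positivity
  smooth := F.contDiff_chart n
  smooth_inv := ⟨F.chartInv n, F.contDiff_chartInv n, F.chartInv_chart hn.ne',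
    F.chart_chartInv hn.ne'⟩
  time_eq := F.time_chart hn.ne'
  flow c := by
    rw [lapse_time F hn, unitNormal_time F hn, fderiv_chart, scale_chart]
    ext i
    fin_cases i <;> simp [ofXiEta, phase] <;> ring

end RosenProfile

/-! ### Causality -/

/-- Both T + h and T − h are monotone, and h grows no faster than T. So T + h is bounded above along
with T, and h is a difference of two convergent functions. -/
theorem exists_tendsto_atTop_of_abs_deriv_le {T T' h h' : ℝ → ℝ} {c : ℝ}
    (hT : ∀ s, HasDerivAt T (T' s) s) (hh : ∀ s, HasDerivAt h (h' s) s)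
    (hle : ∀ s, |h' s| ≤ T' s) (hc : ∀ s, T s ≤ c) : ∃ l, Tendsto h atTop (𝓝 l) := by
  have hm {k k' : ℝ → ℝ} (hk : ∀ s, HasDerivAt k (k' s) s) (hk' : ∀ s, 0 ≤ k' s) : Monotone k :=
    monotone_of_deriv_nonneg (fun s => (hk s).differentiableAt) fun s => by
      rw [(hk s).deriv]; exact hk' s
  have hTm : Monotone T := hm hT fun s => (abs_nonneg _).trans (hle s)
  have hsum : Monotone (fun s => T s + h s) :=
    hm (fun s => (hT s).add (hh s)) fun s => by linarith [neg_abs_le (h' s), hle s]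
  have hdiff : Monotone (fun s => T s - h s) :=
    hm (fun s => (hT s).sub (hh s)) fun s => by linarith [le_abs_self (h' s), hle s]
  have hb : BddAbove (range fun s => T s + h s) := by
    refine ⟨2 * c - T 0 + h 0, ?_⟩
    rintro _ ⟨s, rfl⟩
    have h1 := hsum (le_max_left s 0)
    have h2 := hdiff (le_max_right s 0)
    have h3 := hc (max s 0)
    simp only at h1 h2 ⊢
    linarith
  have hbT : BddAbove (range T) := ⟨c, by rintro _ ⟨s, rfl⟩; exact hc s⟩
  refine ⟨_, ((tendsto_atTop_ciSup hsum hb).sub (tendsto_atTop_ciSup hTm hbT)).congr fun s => ?_⟩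
  simp

theorem exists_tendsto_atBot_of_abs_deriv_le {T T' h h' : ℝ → ℝ} {c : ℝ}
    (hT : ∀ s, HasDerivAt T (T' s) s) (hh : ∀ s, HasDerivAt h (h' s) s)
    (hle : ∀ s, |h' s| ≤ T' s) (hc : ∀ s, c ≤ T s) : ∃ l, Tendsto h atBot (𝓝 l) := by
  obtain ⟨l, hl⟩ := exists_tendsto_atTop_of_abs_deriv_le (T := fun s => -T (-s))
    (T' := fun s => T' (-s)) (h := fun s => h (-s)) (h' := fun s => -h' (-s)) (c := -c)
    (fun s => by simpa [Function.comp_def] using ((hT (-s)).comp s (hasDerivAt_neg s)).fun_neg)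
    (fun s => by simpa [Function.comp_def] using (hh (-s)).comp s (hasDerivAt_neg s))
    (fun s => by simpa using hle (-s)) (fun s => by simpa using hc (-s))
  exact ⟨l, by simpa [Function.comp_def] using hl.comp tendsto_neg_atBot_atTop⟩

namespace RosenProfile

variable (F : RosenProfile)

/-- On a causal curve the derivatives of the transported coordinates a, b, η are bounded by that of
nτ. If τ stayed on one side of c, all of them would converge at the corresponding end and produce an
endpoint. So τ takes the value c, and only once since it increases strictly. -/
theorem isCauchy_time {n : ℝ} (hn : 0 < n) (c : ℝ) :
    F.metric.IsCauchy (F.time n) {q | F.time n q = c} := by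
  intro γ V hγ htop hbot
  have hd (s : ℝ) : HasDerivAt γ (V s) s := hasDerivWithinAt_univ.mp (hγ.2 s (mem_univ s)).1
  have hcaus (s : ℝ) := (F.isFutureCausal_iff hn _ _).mp (hγ.2 s (mem_univ s)).2
  have hτ (s : ℝ) : HasDerivAt (fun s => F.time n (γ s)) (F.timeForm (γ s) (V s) / n) s := by
    rw [← fderiv_time]
    exact ((F.contDiff_time n).differentiable (by simp) (γ s)).hasFDerivAt.comp_hasDerivAt s (hd s)
  have hmono : StrictMono (fun s => F.time n (γ s)) :=
    strictMono_of_deriv_pos fun s => by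
      rw [(hτ s).deriv]; exact div_pos (hcaus s).2 hn
  have hcont : Continuous (fun s => F.time n (γ s)) :=
    continuous_iff_continuousAt.mpr fun s => (hτ s).continuousAt
  have hnτ (s : ℝ) : HasDerivAt (fun s => n * F.time n (γ s)) (F.timeForm (γ s) (V s)) s :=
    ((hτ s).const_mul n).congr_deriv (by field_simp)
  have hcomp (i : Fin 4) (s : ℝ) : HasDerivAt (fun s => γ s i) (V s i) s :=
    (hasDerivAt_pi.mp (hd s)) i
  have hxi (s : ℝ) : HasDerivAt (fun s => xi (γ s)) (xi (V s)) s := by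
    have := (hasFDerivAt_xi (γ s)).comp_hasDerivAt s (hd s)
    rwa [xiL_apply] at this
  have heta (s : ℝ) : HasDerivAt (fun s => eta (γ s)) (eta (V s)) s :=
    (((hcomp 2 s).const_mul 4).sub ((hcomp 3 s).const_mul 3)).div_const 5
  have ha (s : ℝ) : HasDerivAt (fun s => F.Q (F.S (xi (γ s))) - γ s 1)
      (V s 0 - F.timeForm (γ s) (V s)) s :=
    (((F.hasDerivAt_QS _).comp s (hxi s)).sub (hcomp 1 s)).congr_deriv
      (by rw [timeForm, scale]; ring)
  have hb (s : ℝ) : HasDerivAt (fun s => F.S (xi (γ s)) - γ s 0)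
      (-(F.scale (γ s) * V s 0 - xi (V s)) / F.scale (γ s)) s := by
    have := (F.scale_pos (γ s)).ne'
    refine (((F.hasDerivAt_S _).comp s (hxi s)).sub (hcomp 0 s)).congr_deriv ?_
    rw [← scale]
    field_simp
    ring
  have hale (s : ℝ) : |V s 0 - F.timeForm (γ s) (V s)| ≤ F.timeForm (γ s) (V s) := by
    apply abs_le_of_sq_le_sq _ (hcaus s).2.le
    nlinarith [(hcaus s).1, sq_nonneg (F.scale (γ s) * V s 0 - xi (V s)), sq_nonneg (eta (V s))]
  have hele (s : ℝ) : |eta (V s)| ≤ F.timeForm (γ s) (V s) := by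
    apply abs_le_of_sq_le_sq _ (hcaus s).2.le
    nlinarith [(hcaus s).1, sq_nonneg (F.scale (γ s) * V s 0 - xi (V s)),
      sq_nonneg (V s 0 - F.timeForm (γ s) (V s))]
  have hble (s : ℝ) : |-(F.scale (γ s) * V s 0 - xi (V s)) / F.scale (γ s)| ≤
      F.timeForm (γ s) (V s) := by
    rw [abs_div, abs_neg, abs_of_pos (F.scale_pos _)]
    refine (div_le_self (abs_nonneg _) (F.one_le _)).trans ?_
    apply abs_le_of_sq_le_sq _ (hcaus s).2.le
    nlinarith [(hcaus s).1, sq_nonneg (eta (V s)), sq_nonneg (V s 0 - F.timeForm (γ s) (V s))]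
  -- Convergence of the four transported coordinates carries over to γ through the continuous chart;
  -- `l` is used for both ends.
  have hlim {l : Filter ℝ} (hex : ∀ h h' : ℝ → ℝ, (∀ s, HasDerivAt h (h' s) s) →
      (∀ s, |h' s| ≤ F.timeForm (γ s) (V s)) → ∃ y, Tendsto h l (𝓝 y)) :
      ∃ q, Tendsto γ l (𝓝 q) := by
    obtain ⟨t, ht⟩ := hex _ _ hnτ fun s => (abs_of_pos (hcaus s).2).le
    obtain ⟨a, ha⟩ := hex _ _ ha hale
    obtain ⟨b, hb⟩ := hex _ _ hb hble
    obtain ⟨e, he⟩ := hex _ _ heta hele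
    have ht' : Tendsto (fun s => F.time n (γ s)) l (𝓝 (n⁻¹ * t)) :=
      (ht.const_mul n⁻¹).congr fun s => by field_simp
    have hΨ : Tendsto (fun s => F.chartInv n (γ s)) l (𝓝 ![n⁻¹ * t, a, b, e]) := by
      rw [tendsto_pi_nhds]
      intro i
      fin_cases i
      exacts [ht', ha, hb, he]
    refine ⟨_, (((F.contDiff_chart n).continuous.tendsto _).comp hΨ).congr fun s => ?_⟩
    exact F.chart_chartInv hn.ne' (γ s)
  obtain ⟨s₁, hs₁⟩ : ∃ s, c ≤ F.time n (γ s) := by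
    by_contra! hlt
    exact htop <| hlim fun h h' hh hle => exists_tendsto_atTop_of_abs_deriv_le hnτ hh hle
      fun s => mul_le_mul_of_nonneg_left (hlt s).le hn.le
  obtain ⟨s₂, hs₂⟩ : ∃ s, F.time n (γ s) ≤ c := by
    by_contra! hlt
    exact hbot <| hlim fun h h' hh hle => exists_tendsto_atBot_of_abs_deriv_le hnτ hh hle
      fun s => mul_le_mul_of_nonneg_left (hlt s).le hn.le
  obtain ⟨s, hs⟩ := mem_range_of_exists_le_of_exists_ge hcont ⟨s₂, hs₂⟩ ⟨s₁, hs₁⟩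
  exact ⟨s, hs, fun r hr => hmono.injective (hr.trans hs.symm)⟩

/-- A point whose transported coordinates are joined to those of another point by a straight
causal segment lies in its causal past. -/
theorem mem_causalPast_chart {n B : ℝ} (hn : 0 < n) (c c' : Coord 4) (ht : c 0 < c' 0)
    (hP : ∀ s ∈ segment ℝ (phase n c) (phase n c'), F.P s ≤ B)
    (hB : (c' 1 - c 1) ^ 2 + B ^ 2 * (c' 2 - c 2) ^ 2 + (c' 3 - c 3) ^ 2 ≤
      n ^ 2 * (c' 0 - c 0) ^ 2) :
    F.chart n c ∈ F.metric.causalPast (F.time n) (F.chart n c') := by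
  right
  have hd (s : ℝ) : HasDerivAt (fun s : ℝ => c + s • (c' - c)) (c' - c) s := by
    simpa using ((hasDerivAt_id s).smul_const (c' - c)).const_add c
  have hline : Continuous (fun s : ℝ => c + s • (c' - c)) :=
    continuous_iff_continuousAt.mpr fun s => (hd s).continuousAt
  refine ⟨fun s => F.chart n (c + s • (c' - c)),
    fun s => fderiv ℝ (F.chart n) (c + s • (c' - c)) (c' - c), ⟨?_, fun s hs => ⟨?_, ?_⟩⟩, ?_, ?_⟩
  · exact ((((F.contDiff_chart n).continuous_fderiv (by simp)).comp hline).clm_apply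
      continuous_const).continuousOn
  · exact (((F.contDiff_chart n).differentiable (by simp) _).hasFDerivAt.comp_hasDerivAt s
      (hd s)).hasDerivWithinAt
  · have hph : phase n (c + s • (c' - c)) ∈ segment ℝ (phase n c) (phase n c') :=
      ⟨1 - s, s, by linarith [hs.2], hs.1, by ring, by simp [phase]; ring⟩
    constructor
    · rw [ip_fderiv_chart]
      have h1 := hP _ hph
      have h2 : F.P (phase n (c + s • (c' - c))) ^ 2 ≤ B ^ 2 := by
        have := F.P_pos (phase n (c + s • (c' - c)))
        gcongr
      have h3 := mul_le_mul_of_nonneg_right h2 (sq_nonneg (c' 2 - c 2))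
      simp only [Pi.sub_apply]
      nlinarith
    · rw [ip_unitNormal F hn, timeForm_fderiv_chart, neg_lt_zero]
      exact mul_pos hn (sub_pos.mpr ht)
  · simp
  · simp

/-! ### Intrinsic geometry of the slices -/

/-- The metric `da² + P(a + b + r)² db² + dη²`. -/
def warped (r : ℝ) : MetricField 3 := fun x => Matrix.diagonal ![1, F.P (x 0 + x 1 + r) ^ 2, 1]

theorem sliceMetric_chart (n t : ℝ) :
    F.metric.sliceMetric (m := 3) (F.chart n) t = F.warped (n * t) := by
  ext x i j
  rw [MetricField.sliceMetric, Matrix.of_apply, ip_fderiv_chart]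
  have h : phase n (Fin.cons t x : Coord 4) = x 0 + x 1 + n * t := rfl
  rw [h, warped]
  fin_cases i <;> fin_cases j <;> simp [Fin.ext_iff]

theorem ip_warped (r : ℝ) (x V : Coord 3) :
    (F.warped r).ip x V V = V 0 ^ 2 + F.P (x 0 + x 1 + r) ^ 2 * V 1 ^ 2 + V 2 ^ 2 := by
  simp [MetricField.ip, warped, Fin.sum_univ_three, Matrix.diagonal_apply]
  ring

theorem inv_warped (r : ℝ) (x : Coord 3) :
    (F.warped r x)⁻¹ = Matrix.diagonal ![1, (F.P (x 0 + x 1 + r) ^ 2)⁻¹, 1] := by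
  have := (F.P_pos (x 0 + x 1 + r)).ne'
  apply Matrix.inv_eq_right_inv
  rw [warped, Matrix.diagonal_mul_diagonal, ← Matrix.diagonal_one]
  congr 1
  ext i
  fin_cases i <;> simp [this]

theorem pd_warped (r : ℝ) (x : Coord 3) (i l j : Fin 3) :
    pd i (fun y => F.warped r y l j) x =
      2 * F.P (x 0 + x 1 + r) * F.P' (x 0 + x 1 + r) * (![1, 1, 0] : Coord 3) i *
        (![0, 1, 0] : Coord 3) l * (![0, 1, 0] : Coord 3) j := by
  have hP : ContDiff ℝ ∞ (fun y : Coord 3 => F.P (y 0 + y 1 + r) ^ 2) :=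
    (F.contDiff_P.comp (by fun_prop)).pow 2
  have h : pd i (fun y : Coord 3 => F.P (y 0 + y 1 + r) ^ 2) x =
      2 * F.P (x 0 + x 1 + r) * F.P' (x 0 + x 1 + r) * (![1, 1, 0] : Coord 3) i := by
    apply fderiv_apply_eq_of_hasDerivAt (hP.differentiable (by simp) x)
    have hlin (k : Fin 3) : HasDerivAt (fun s : ℝ => x k + s * (Pi.single i 1 : Coord 3) k)
        ((Pi.single i 1 : Coord 3) k) 0 := by
      simpa using ((hasDerivAt_id (0 : ℝ)).mul_const ((Pi.single i 1 : Coord 3) k)).const_add (x k)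
    have h1 := ((hlin 0).fun_add (hlin 1)).add_const r
    have h2 := ((F.hasDerivAt_P _).comp 0 h1).fun_pow 2
    refine h2.congr_deriv ?_
    simp only [zero_mul, add_zero, Function.comp]
    fin_cases i <;> simp
  fin_cases l <;> fin_cases j <;> simp [warped, pd_const, h]

theorem christoffelVec_warped (r : ℝ) (x W : Coord 3) :
    (F.warped r).christoffelVec x W W =
      ![-(F.P (x 0 + x 1 + r) * F.P' (x 0 + x 1 + r) * W 1 ^ 2),
        F.P' (x 0 + x 1 + r) / F.P (x 0 + x 1 + r) * (2 * W 0 * W 1 + W 1 ^ 2), 0] := by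
  have hp := (F.P_pos (x 0 + x 1 + r)).ne'
  ext k
  simp only [MetricField.christoffelVec, MetricField.christoffel, pd_warped, inv_warped,
    Fin.sum_univ_three]
  fin_cases k <;> simp <;> (try field_simp) <;> ring

theorem secondDeformation_chart (n t : ℝ) (x W : Coord 3) :
    F.metric.secondDeformation (m := 3) (F.chart n) t x W =
      (F.warped (n * t)).christoffelVec x W W - (F.warped 0).christoffelVec x W W := by
  rw [MetricField.secondDeformation, sliceMetric_chart, sliceMetric_chart, mul_zero]

theorem refSq_fderiv_chart {n : ℝ} (hn : 0 < n) (c W : Coord 4) :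
    F.metric.refSq (F.time n) (F.chart n c) (fderiv ℝ (F.chart n) c W) =
      n ^ 2 * W 0 ^ 2 + W 1 ^ 2 + F.P (phase n c) ^ 2 * W 2 ^ 2 + W 3 ^ 2 := by
  rw [refSq_time F hn, timeForm_fderiv_chart, fderiv_chart, scale_chart, xi_ofXiEta, eta_ofXiEta]
  simp [ofXiEta, phase]; ring

/-- Here p, d stand for P, P' on the slice at time t, p₀, d₀ for their values at time 0, and A, B, E
for the components of the vector. Each component of ω is a difference of two terms of the same sign
pattern, so it is bounded by 2εG in the norm of slice t; comparability of p and p₀ controls the term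
from time 0. -/
theorem sqrt_warped_connection_diff_le {p p₀ d d₀ ε A B E : ℝ} (hp : 1 ≤ p) (hp₀ : p ≤ p₀)
    (hp₀' : p₀ ≤ 2 * p) (hd : 0 ≤ d) (hdε : d ≤ ε) (hd₀ : 0 ≤ d₀) (hd₀ε : d₀ ≤ ε) :
    Real.sqrt ((-(p * d * B ^ 2) - -(p₀ * d₀ * B ^ 2)) ^ 2 +
      p ^ 2 * (d / p * (2 * A * B + B ^ 2) - d₀ / p₀ * (2 * A * B + B ^ 2)) ^ 2) ≤
      4 * ε * (A ^ 2 + p ^ 2 * B ^ 2 + E ^ 2) := by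
  set G := A ^ 2 + p ^ 2 * B ^ 2 + E ^ 2 with hG
  have hε : 0 ≤ ε := hd.trans hdε
  have hp₀0 : 0 ≤ p₀ := by linarith
  have hG0 : 0 ≤ G := by positivity
  have hpB : p * B ^ 2 ≤ G := by
    have h0 : 0 ≤ p * (p - 1) * B ^ 2 :=
      mul_nonneg (mul_nonneg (by linarith) (sub_nonneg.mpr hp)) (sq_nonneg B)
    rw [hG]
    nlinarith [sq_nonneg A, sq_nonneg E]
  have hpB0 : 0 ≤ p * B ^ 2 := by positivity
  have h1 : |-(p * d * B ^ 2) - -(p₀ * d₀ * B ^ 2)| ≤ 2 * ε * G := by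
    have ha : p * d * B ^ 2 ≤ ε * G := by
      have := mul_le_mul hdε hpB hpB0 hε
      linarith
    have hb : p₀ * d₀ * B ^ 2 ≤ 2 * ε * G := by
      have h3 : p₀ * B ^ 2 ≤ 2 * G := by nlinarith [sq_nonneg B]
      have := mul_le_mul hd₀ε h3 (mul_nonneg hp₀0 (sq_nonneg B)) hε
      linarith
    have hc : 0 ≤ p * d * B ^ 2 := by positivity
    have hd' : 0 ≤ p₀ * d₀ * B ^ 2 := by positivity
    have : 0 ≤ ε * G := by positivity
    rw [abs_le]
    constructor <;> linarith
  have h2 : |p * (d / p * (2 * A * B + B ^ 2) - d₀ / p₀ * (2 * A * B + B ^ 2))| ≤ 2 * ε * G := by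
    have e : p * (d / p * (2 * A * B + B ^ 2) - d₀ / p₀ * (2 * A * B + B ^ 2)) =
      (d / p - d₀ / p₀) * (p * (2 * A * B + B ^ 2)) := by ring
    have hq : |d / p - d₀ / p₀| ≤ ε := by
      have h3 : 0 ≤ d / p := by positivity
      have h4 : 0 ≤ d₀ / p₀ := div_nonneg hd₀ (by linarith)
      have h5 : d / p ≤ ε := (div_le_self hd hp).trans hdε
      have h6 : d₀ / p₀ ≤ ε := (div_le_self hd₀ (by linarith)).trans hd₀ε
      rw [abs_le]
      constructor <;> linarith
    have hr : |p * (2 * A * B + B ^ 2)| ≤ 2 * G := by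
      have h7 : |2 * A * (p * B)| ≤ A ^ 2 + (p * B) ^ 2 := by
        rw [abs_le]
        constructor <;> nlinarith [sq_nonneg (A + p * B), sq_nonneg (A - p * B)]
      have h8 : A ^ 2 + (p * B) ^ 2 ≤ G := by rw [hG]; nlinarith [sq_nonneg E]
      rw [abs_le] at h7 ⊢
      constructor <;> nlinarith [h7.1, h7.2]
    rw [e, abs_mul]
    have := mul_le_mul hq hr (abs_nonneg _) hε
    linarith
  apply Real.sqrt_le_iff.mpr
  refine ⟨by positivity, ?_⟩
  have h3 := sq_le_sq' (by linarith [neg_abs_le (-(p * d * B ^ 2) - -(p₀ * d₀ * B ^ 2))])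
    ((le_abs_self _).trans h1)
  have h4 := sq_le_sq' (by linarith [neg_abs_le (p * (d / p * (2 * A * B + B ^ 2) -
    d₀ / p₀ * (2 * A * B + B ^ 2)))]) ((le_abs_self _).trans h2)
  rw [mul_pow p] at h4
  nlinarith [sq_nonneg (ε * G)]

/-- Between slice t and slice 0 the scale factor grows by at most ε·nL ≤ 1 ≤ P, hence at most
doubles. -/
theorem secondDeformation_chart_le {n ε L : ℝ} (hn : 0 < n) (hP0 : ∀ s, 0 ≤ F.P' s)
    (hP : ∀ s, F.P' s ≤ ε) (hL : ε * (n * L) ≤ 1) {t : ℝ} (ht : t ∈ Icc (-L) 0) (x : Coord 3)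
    (a : ℝ) (W : Coord 3) :
    Real.sqrt ((F.metric.sliceMetric (m := 3) (F.chart n) t).ip x
      (F.metric.secondDeformation (m := 3) (F.chart n) t x W)
      (F.metric.secondDeformation (m := 3) (F.chart n) t x W)) ≤
      4 * ε * F.metric.refSq (F.time n) (F.chart n (Fin.cons t x : Coord 4))
        (fderiv ℝ (F.chart n) (Fin.cons t x : Coord 4) (Fin.cons a W : Coord 4)) := by
  have hε : 0 ≤ ε := (hP0 0).trans (hP 0)
  have hmono : Monotone F.P := monotone_of_deriv_nonneg
    (fun s => (F.hasDerivAt_P s).differentiableAt) fun s => by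
      rw [(F.hasDerivAt_P s).deriv]; exact hP0 s
  have hnt : n * t ≤ 0 := mul_nonpos_of_nonneg_of_nonpos hn.le ht.2
  have hp : F.P (x 0 + x 1 + n * t) ≤ F.P (x 0 + x 1 + 0) := hmono (by linarith)
  have hp' : F.P (x 0 + x 1 + 0) ≤ 2 * F.P (x 0 + x 1 + n * t) := by
    have h1 : F.P (x 0 + x 1 + 0) - F.P (x 0 + x 1 + n * t) ≤
        ε * ((x 0 + x 1 + 0) - (x 0 + x 1 + n * t)) :=
      image_sub_le_mul_sub_of_deriv_le (fun s => (F.hasDerivAt_P s).differentiableAt)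
        (fun s => by rw [(F.hasDerivAt_P s).deriv]; exact hP s) (by linarith)
    have h2 : ε * ((x 0 + x 1 + 0) - (x 0 + x 1 + n * t)) ≤ ε * (n * L) := by
      apply mul_le_mul_of_nonneg_left _ hε
      nlinarith [ht.1]
    linarith [F.one_le (x 0 + x 1 + n * t)]
  have h := sqrt_warped_connection_diff_le (A := W 0) (B := W 1) (E := W 2)
    (F.one_le _) hp hp' (hP0 (x 0 + x 1 + n * t)) (hP _) (hP0 (x 0 + x 1 + 0)) (hP _)
  rw [sliceMetric_chart, secondDeformation_chart, ip_warped, christoffelVec_warped,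
    christoffelVec_warped, refSq_fderiv_chart F hn]
  refine le_trans (le_of_eq ?_) (h.trans ?_)
  · simp
  · apply mul_le_mul_of_nonneg_left _ (by positivity)
    have e0 : (Fin.cons a W : Coord 4) 0 = a := rfl
    have e1 : (Fin.cons a W : Coord 4) 1 = W 0 := rfl
    have e2 : (Fin.cons a W : Coord 4) 2 = W 1 := rfl
    have e3 : (Fin.cons a W : Coord 4) 3 = W 2 := rfl
    have e4 : phase n (Fin.cons t x : Coord 4) = x 0 + x 1 + n * t := rfl
    rw [e0, e1, e2, e3, e4]
    nlinarith [mul_nonneg (sq_nonneg n) (sq_nonneg a)]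

/-- The initial slice is flat in the region where the scale factor is constant. -/
theorem le_injRadius_warped (h1 : ∀ s ≤ 0, F.P s = 1) (h0 : ∀ s ≤ 0, F.P' s = 0) {x : Coord 3}
    {r : ℝ} (hr : 0 < r) (hx : x 0 + x 1 ≤ -(2 * r)) :
    ENNReal.ofReal r ≤ (F.warped 0).injRadius x := by
  -- Where P = 1 the slice is Euclidean and the exponential map is a translation. Each of the first
  -- two coordinates grows by at most r, so their sum stays nonpositive.
  refine le_sSup ⟨r, rfl, fun v => x + v, fun y => y - x, ?_, ?_, ?_, ?_, ?_⟩
  · intro v hv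
    have hball : v 0 ^ 2 + v 1 ^ 2 + v 2 ^ 2 < r ^ 2 := by
      have : Real.sqrt ((F.warped 0).ip x v v) < r := hv
      rw [ip_warped, h1 _ (by linarith), Real.sqrt_lt' hr] at this
      linarith
    have hv0 : v 0 ≤ r := by nlinarith [sq_nonneg (v 1), sq_nonneg (v 2)]
    have hv1 : v 1 ≤ r := by nlinarith [sq_nonneg (v 0), sq_nonneg (v 2)]
    refine ⟨fun s => x + s • v, fun _ => v, fun s hs => ⟨?_, ?_⟩, by simp, rfl, by simp⟩
    · simpa using ((hasDerivWithinAt_id s (Icc 0 1)).smul_const v).const_add x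
    · have hz : F.P' ((x + s • v) 0 + (x + s • v) 1 + 0) = 0 := by
        apply h0
        simp only [Pi.add_apply, Pi.smul_apply, smul_eq_mul, add_zero]
        nlinarith [hs.1, hs.2]
      rw [christoffelVec_warped, hz]
      refine (hasDerivWithinAt_const s (Icc 0 1) v).congr_deriv ?_
      ext i
      fin_cases i <;> simp
  · fun_prop
  · have hopen : IsOpen ((F.warped 0).tangentBall x r) := by
      apply isOpen_lt _ continuous_const
      simp only [ip_warped]
      fun_prop
    exact (Homeomorph.addLeft x).isOpenMap _ hopen
  · fun_prop
  · intro v _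
    simp

/-! ### Null vectors, their orthogonal complements, and null geodesics -/

theorem ip_coframe (q V W : Coord 4) : F.metric.ip q V W =
    (F.scale q * V 0 - xi V) * (F.scale q * W 0 - xi W) +
      (V 0 - F.timeForm q V) * (W 0 - F.timeForm q W) + eta V * eta W -
      F.timeForm q V * F.timeForm q W := by
  rw [ip_metric, timeForm, timeForm]; ring

/-- Cauchy–Schwarz for the spatial parts of X and Y in the orthogonal coframe. -/
theorem ip_nonneg_of_orthogonal_null {q X Y : Coord 4} (hX : F.metric.ip q X X = 0)
    (hXt : F.timeForm q X ≠ 0) (hXY : F.metric.ip q X Y = 0) : 0 ≤ F.metric.ip q Y Y := by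
  rw [ip_coframe] at *
  generalize F.timeForm q X = Z at *
  generalize F.timeForm q Y = Z' at *
  generalize F.scale q * X 0 - xi X = a at *
  generalize F.scale q * Y 0 - xi Y = a' at *
  generalize X 0 - Z = b at *
  generalize Y 0 - Z' = b' at *
  generalize eta X = e at *
  generalize eta Y = e' at *
  have hZ : 0 < Z ^ 2 := by positivity
  have h : (Z * Z') ^ 2 ≤ Z ^ 2 * (a' * a' + b' * b' + e' * e') := by
    have h1 : Z * Z' = a * a' + b * b' + e * e' := by linarith
    have h2 : Z ^ 2 = a * a + b * b + e * e := by linarith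
    rw [h1, h2]
    nlinarith [sq_nonneg (a * b' - b * a'), sq_nonneg (a * e' - e * a'),
      sq_nonneg (b * e' - e * b')]
  have h3 : Z ^ 2 * Z' ^ 2 ≤ Z ^ 2 * (a' * a' + b' * b' + e' * e') := by linarith
  have h4 := le_of_mul_le_mul_left h3 hZ
  linarith

theorem eq_zero_of_null_of_timeForm_eq_zero {q X : Coord 4} (hX : F.metric.ip q X X = 0)
    (hXt : F.timeForm q X = 0) : X = 0 := by
  rw [ip_self, hXt] at hX
  have h0 : X 0 = 0 := by
    nlinarith [sq_nonneg (F.scale q * X 0 - xi X), sq_nonneg (X 0), sq_nonneg (eta X)]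
  rw [h0] at hX
  have hxi : xi X = 0 := by nlinarith [sq_nonneg (xi X), sq_nonneg (eta X)]
  have heta : eta X = 0 := by nlinarith [sq_nonneg (xi X), sq_nonneg (eta X)]
  have h1 : X 1 = 0 := by rw [timeForm, h0, hxi] at hXt; linarith
  rw [← ofXiEta_self X, h0, h1, hxi, heta]
  ext i
  fin_cases i <;> simp [ofXiEta]

theorem eq_of_hasDerivAt_zero {f : ℝ → ℝ} (hf : ∀ s, HasDerivAt f 0 s) (s t : ℝ) : f s = f t :=
  is_const_of_deriv_eq_zero (fun s => (hf s).differentiableAt) (fun s => (hf s).deriv) s t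

variable {F}

/-- The geodesic equation in components. -/
theorem hasDerivAt_geodesic {γ V : ℝ → Coord 4} (h : F.metric.IsGeodesicOn γ V univ) (s : ℝ) :
    HasDerivAt (fun s => xi (γ s)) (xi (V s)) s ∧ HasDerivAt (fun s => V s 0) 0 s ∧
      HasDerivAt (fun s => V s 1) (2 * F.f' (xi (γ s)) * V s 0 * xi (V s)) s ∧
      HasDerivAt (fun s => xi (V s)) (F.f' (xi (γ s)) * V s 0 ^ 2) s ∧
      HasDerivAt (fun s => eta (V s)) 0 s := by
  have h1 := hasDerivWithinAt_univ.mp (h s (mem_univ s)).1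
  have h2 := hasDerivWithinAt_univ.mp (h s (mem_univ s)).2
  have hcomp (i : Fin 4) : HasDerivAt (fun s => V s i) (F.f' (xi (γ s)) *
      (dxi i * (V s 0 * V s 0) + dv i * (V s 0 * xi (V s) + V s 0 * xi (V s)))) s := by
    refine ((hasDerivAt_pi.mp h2) i).congr_deriv ?_
    rw [Pi.neg_apply, metric, MetricField.christoffelVec_planeWave_ridge F.hasDerivAt_f, neg_neg]
  refine ⟨?_, ?_, ?_, ?_, ?_⟩
  · have := (hasFDerivAt_xi (γ s)).comp_hasDerivAt s h1
    rwa [xiL_apply] at this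
  · exact (hcomp 0).congr_deriv (by simp [dxi, dv])
  · exact (hcomp 1).congr_deriv (by simp [dxi, dv]; ring)
  · exact ((((hcomp 2).const_mul 3).add ((hcomp 3).const_mul 4)).div_const 5).congr_deriv
      (by simp [dxi, dv]; ring)
  · exact ((((hcomp 2).const_mul 4).sub ((hcomp 3).const_mul 3)).div_const 5).congr_deriv
      (by simp [dxi, dv]; ring)

theorem ip_velocity_eq {γ V : ℝ → Coord 4} (h : F.metric.IsGeodesicOn γ V univ) (s t : ℝ) :
    F.metric.ip (γ s) (V s) (V s) = F.metric.ip (γ t) (V t) (V t) := by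
  refine eq_of_hasDerivAt_zero (f := fun s => F.metric.ip (γ s) (V s) (V s)) (fun s => ?_) s t
  obtain ⟨hx, h0, h1, h2, h3⟩ := hasDerivAt_geodesic h s
  have hf : HasDerivAt (fun s => F.f (xi (γ s))) (F.f' (xi (γ s)) * xi (V s)) s :=
    (F.hasDerivAt_f _).comp s hx
  simp only [metric, MetricField.ip_planeWave_ridge]
  refine ((((((hf.const_mul 2).mul h0).mul h0).sub (h0.mul h1)).sub (h1.mul h0)).add
    (h2.mul h2) |>.add (h3.mul h3)).congr_deriv ?_
  ring

/-- The system is triangular: V⁰ is constant, and once it vanishes all other components are constant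
too. -/
theorem velocity_eq_zero {γ V : ℝ → Coord 4} (h : F.metric.IsGeodesicOn γ V univ) {s : ℝ}
    (hs : V s = 0) (t : ℝ) : V t = 0 := by
  have h0 (t : ℝ) : V t 0 = 0 := by
    rw [eq_of_hasDerivAt_zero (fun s => (hasDerivAt_geodesic h s).2.1) t s, hs]; rfl
  have h1 (t : ℝ) : V t 1 = 0 := by
    rw [eq_of_hasDerivAt_zero (f := fun s => V s 1) (fun r =>
      (hasDerivAt_geodesic h r).2.2.1.congr_deriv (by rw [h0]; ring)) t s, hs]; rfl
  have h2 (t : ℝ) : xi (V t) = 0 := by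
    rw [eq_of_hasDerivAt_zero (f := fun s => xi (V s)) (fun r =>
      (hasDerivAt_geodesic h r).2.2.2.1.congr_deriv (by rw [h0]; ring)) t s, hs]; simp [xi]
  have h3 (t : ℝ) : eta (V t) = 0 := by
    rw [eq_of_hasDerivAt_zero (fun s => (hasDerivAt_geodesic h s).2.2.2.2) t s, hs]; simp [eta]
  rw [← ofXiEta_self (V t), h0, h1, h2, h3]
  ext i
  fin_cases i <;> simp [ofXiEta]

/-- This makes K_Rm⟨Y, Y⟩ nonnegative, so that non-positive curvature implies the upper bound. The
velocity stays null and nonzero along the geodesic, so dτ never vanishes on it and the normalization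
by τ is genuine. -/
theorem ip_nonneg_of_isNullConeTangent {n : ℝ} (hn : 0 < n) {p q X Y : Coord 4} {I : Set ℝ}
    (hX : F.metric.IsNullConeTangent (F.time n) p I q X) (hXY : F.metric.ip q X Y = 0) :
    0 ≤ F.metric.ip q Y Y := by
  obtain ⟨γ, V, s, hγ, hγ0, hnull, hpast, -, rfl, -, rfl⟩ := hX
  have hV : F.metric.ip (γ s) (V s) (V s) = 0 := by
    rw [ip_velocity_eq hγ s 0, hγ0, hnull]
  have ht : F.timeForm (γ s) (V s) ≠ 0 := fun h => by
    have h0 := velocity_eq_zero hγ (F.eq_zero_of_null_of_timeForm_eq_zero hV h) 0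
    rw [ip_unitNormal F hn, h0] at hpast
    simp [timeForm, xi] at hpast
  refine F.ip_nonneg_of_orthogonal_null hV ht ?_
  rw [fderiv_time] at hXY
  have e (c : ℝ) : F.metric.ip (γ s) (c • V s) Y = c * F.metric.ip (γ s) (V s) Y := by
    simp only [ip_metric, xi, eta, Pi.smul_apply, smul_eq_mul]; ring
  rw [e, mul_eq_zero] at hXY
  exact hXY.resolve_left (inv_ne_zero (div_ne_zero ht hn.ne'))

variable (F)

/-- A past null vector adapted to the orthogonal coframe. -/
def nullVec (q : Coord 4) : Coord 4 :=
  ofXiEta (-1) (1 / 2 - F.scale q ^ 2) (F.scale q) 0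

/-- A unit spacelike vector orthogonal to `nullVec`. -/
def screenVec (q : Coord 4) : Coord 4 := ofXiEta 0 (-F.scale q) 1 0

theorem timeForm_nullVec (q : Coord 4) :
    F.timeForm q (F.nullVec q) = -(1 / 2 + 2 * F.scale q ^ 2) := by
  rw [timeForm, nullVec, xi_ofXiEta]; simp [ofXiEta]; ring

/-- `nullVec` normalized by `dτ = 1`. -/
def unitNullVec (n : ℝ) (q : Coord 4) : Coord 4 :=
  (fderiv ℝ (F.time n) q (F.nullVec q))⁻¹ • F.nullVec q

theorem ip_nullVec_self (q : Coord 4) : F.metric.ip q (F.nullVec q) (F.nullVec q) = 0 := by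
  rw [ip_metric, nullVec, xi_ofXiEta, eta_ofXiEta]; simp [ofXiEta]; ring

theorem ip_unitNullVec_self (n : ℝ) (q : Coord 4) :
    F.metric.ip q (F.unitNullVec n q) (F.unitNullVec n q) = 0 := by
  have e (c : ℝ) (W : Coord 4) : F.metric.ip q (c • W) (c • W) = c ^ 2 * F.metric.ip q W W := by
    simp only [ip_metric, xi, eta, Pi.smul_apply, smul_eq_mul]; ring
  rw [unitNullVec, e, ip_nullVec_self, mul_zero]

theorem fderiv_time_unitNullVec {n : ℝ} (hn : 0 < n) (q : Coord 4) :
    fderiv ℝ (F.time n) q (F.unitNullVec n q) = 1 := by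
  rw [unitNullVec, map_smul, smul_eq_mul, inv_mul_cancel₀]
  rw [fderiv_time, timeForm_nullVec]
  have : 0 < 1 / 2 + 2 * F.scale q ^ 2 := by positivity
  exact div_ne_zero (neg_ne_zero.mpr this.ne') hn.ne'

theorem ip_unitNullVec_screenVec (n : ℝ) (q : Coord 4) :
    F.metric.ip q (F.unitNullVec n q) (F.screenVec q) = 0 := by
  have h : F.metric.ip q (F.nullVec q) (F.screenVec q) = 0 := by
    rw [ip_metric, nullVec, screenVec, xi_ofXiEta, xi_ofXiEta, eta_ofXiEta, eta_ofXiEta]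
    simp [ofXiEta]
  have e (c : ℝ) (W Y : Coord 4) : F.metric.ip q (c • W) Y = c * F.metric.ip q W Y := by
    simp only [ip_metric, xi, eta, Pi.smul_apply, smul_eq_mul]; ring
  rw [unitNullVec, e, h, mul_zero]

theorem ip_screenVec_self (q : Coord 4) : F.metric.ip q (F.screenVec q) (F.screenVec q) = 1 := by
  rw [ip_metric, screenVec, xi_ofXiEta, eta_ofXiEta]; simp [ofXiEta]

theorem curvatureForm_unitNullVec (n : ℝ) (q : Coord 4) :
    F.metric.curvatureForm q (F.unitNullVec n q) (F.screenVec q) =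
      -(F.f'' (xi q) * (n / (1 / 2 + 2 * F.scale q ^ 2)) ^ 2) := by
  rw [metric, MetricField.curvatureForm_planeWave_ridge F.hasDerivAt_f F.hasDerivAt_f',
    unitNullVec, fderiv_time, timeForm_nullVec, screenVec, xi_ofXiEta]
  have e : (ofXiEta 0 (-F.scale q) 1 0) 0 = 0 := rfl
  have e' : F.nullVec q 0 = -1 := rfl
  rw [e, Pi.smul_apply, e', zero_mul, sub_zero, mul_one, smul_eq_mul, mul_neg_one, neg_sq, inv_div,
    div_neg, neg_sq]

/-- A past null geodesic in the `(u, v, ξ)`-plane, written with the transported coordinates. -/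
theorem isNullConeTangent_unitNullVec {n : ℝ} (hn : 0 < n) {I : Set ℝ} (σ s v₀ : ℝ) (hs : 0 ≤ s)
    (hI : F.time n (ofXiEta (-s) (v₀ + s / 2 - F.Q (σ + s)) (F.X (σ + s)) 0) ∈ I) :
    F.metric.IsNullConeTangent (F.time n) (ofXiEta 0 (v₀ - F.Q σ) (F.X σ) 0) I
      (ofXiEta (-s) (v₀ + s / 2 - F.Q (σ + s)) (F.X (σ + s)) 0)
      (F.unitNullVec n (ofXiEta (-s) (v₀ + s / 2 - F.Q (σ + s)) (F.X (σ + s)) 0)) := by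
  have hscale (u v e s : ℝ) : F.scale (ofXiEta u v (F.X s) e) = F.P s := by
    rw [scale, xi_ofXiEta, S_X]
  have hσ (s : ℝ) : HasDerivAt (fun s => σ + s) 1 s := (hasDerivAt_id s).const_add σ
  have hX (s : ℝ) : HasDerivAt (fun s => F.X (σ + s)) (F.P (σ + s)) s := by
    simpa [Function.comp_def] using (F.hasDerivAt_X (σ + s)).comp s (hσ s)
  have hP (s : ℝ) : HasDerivAt (fun s => F.P (σ + s)) (F.P' (σ + s)) s := by
    simpa [Function.comp_def] using (F.hasDerivAt_P (σ + s)).comp s (hσ s)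
  have hQ (s : ℝ) : HasDerivAt (fun s => F.Q (σ + s)) (F.P (σ + s) ^ 2) s := by
    simpa [Function.comp_def] using (F.hasDerivAt_Q (σ + s)).comp s (hσ s)
  -- With u' = −1 this says that X itself solves Newton's equation X'' = f'(X).
  have hf' (s : ℝ) : F.f' (F.X (σ + s)) = F.P' (σ + s) := by rw [f', S_X]
  refine ⟨fun s => ofXiEta (-s) (v₀ + s / 2 - F.Q (σ + s)) (F.X (σ + s)) 0,
    fun s => ofXiEta (-1) (1 / 2 - F.P (σ + s) ^ 2) (F.P (σ + s)) 0, s,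
    MetricField.isGeodesicOn_ofXiEta F.hasDerivAt_f ?_ ?_ ?_ ?_ ?_ ?_ ?_ ?_, by simp, ?_, ?_, hs,
    rfl, hI, ?_⟩
  · exact fun s _ => (hasDerivAt_neg s).hasDerivWithinAt
  · exact fun s _ => ((((hasDerivAt_id s).div_const 2).const_add v₀).sub (hQ s)).hasDerivWithinAt
  · exact fun s _ => (hX s).hasDerivWithinAt
  · exact fun s _ => hasDerivWithinAt_const _ _ _
  · exact fun s _ => hasDerivWithinAt_const _ _ _
  · intro s _
    refine (((hP s).fun_pow 2).const_sub (1 / 2)).hasDerivWithinAt.congr_deriv ?_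
    rw [hf']; simp; ring
  · intro s _
    refine (hP s).hasDerivWithinAt.congr_deriv ?_
    rw [hf']; ring
  · exact fun s _ => hasDerivWithinAt_const _ _ _
  · have := F.ip_nullVec_self (ofXiEta 0 (v₀ - F.Q σ) (F.X σ) 0)
    rw [nullVec, hscale] at this
    simpa using this
  · have := F.timeForm_nullVec (ofXiEta 0 (v₀ - F.Q σ) (F.X σ) 0)
    rw [nullVec, hscale] at this
    rw [ip_unitNormal F hn]
    simp only [add_zero]
    rw [this, neg_neg]
    positivity
  · rw [unitNullVec, nullVec, hscale]

end RosenProfile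

/-! ### Construction of the scale factor -/

theorem hasDerivAt_primitive {g : ℝ → ℝ} (hg : Continuous g) (s : ℝ) :
    HasDerivAt (fun s => ∫ r in (0 : ℝ)..s, g r) (g s) s :=
  (hg.integral_hasStrictDerivAt 0 s).hasDerivAt

theorem contDiff_infty_of_hasDerivAt {h g : ℝ → ℝ} (hh : ∀ s, HasDerivAt h (g s) s)
    (hg : ContDiff ℝ ∞ g) : ContDiff ℝ ∞ h := by
  rw [contDiff_infty_iff_deriv]
  refine ⟨fun s => (hh s).differentiableAt, ?_⟩
  rwa [show deriv h = g from funext fun s => (hh s).deriv]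

theorem add_le_of_one_le_deriv {h g : ℝ → ℝ} (hh : ∀ s, HasDerivAt h (g s) s)
    (hg : ∀ s, 1 ≤ g s) {s t : ℝ} (hst : s ≤ t) : h s + (t - s) ≤ h t := by
  have := mul_sub_le_image_sub_of_le_deriv (fun s => (hh s).differentiableAt) (C := 1)
    (fun s => by rw [(hh s).deriv]; exact hg s) hst
  linarith

/-- A smooth function on the line whose derivative is at least one has a smooth inverse. -/
theorem exists_contDiff_inverse {h g : ℝ → ℝ} (hh : ∀ s, HasDerivAt h (g s) s)
    (hg : ∀ s, 1 ≤ g s) (hs : ContDiff ℝ ∞ h) :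
    ∃ k : ℝ → ℝ, ContDiff ℝ ∞ k ∧ (∀ z, h (k z) = z) ∧ ∀ s, k (h s) = s := by
  have hmono : StrictMono h := strictMono_of_deriv_pos fun s => by
    rw [(hh s).deriv]; exact one_pos.trans_le (hg s)
  have hsurj : Function.Surjective h := by
    apply hs.continuous.surjective
    · refine tendsto_atTop_mono' _ ?_ (tendsto_atTop_add_const_left _ (h 0) tendsto_id)
      filter_upwards [eventually_ge_atTop 0] with s hs
      simpa using add_le_of_one_le_deriv hh hg hs
    · refine tendsto_atBot_mono' _ ?_ (tendsto_atBot_add_const_left _ (h 0) tendsto_id)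
      filter_upwards [eventually_le_atBot 0] with s hs
      have := add_le_of_one_le_deriv hh hg hs
      simp only [id]
      linarith
  set e := hmono.orderIsoOfSurjective h hsurj with he
  refine ⟨e.symm, ?_, fun z => e.apply_symm_apply z, fun s => e.symm_apply_apply s⟩
  rw [contDiff_iff_contDiffAt]
  intro z
  exact OpenPartialHomeomorph.contDiffAt_symm_deriv
    (f := e.toHomeomorph.toOpenPartialHomeomorph) (one_pos.trans_le (hg (e.symm z))).ne' trivial
    (hh (e.symm z)) hs.contDiffAt

theorem exists_smoothTransition_deriv_ge :
    ∃ α β : ℝ, 0 ≤ α ∧ α < β ∧ β ≤ 1 ∧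
      ∀ s ∈ Icc α β, 1 / 2 ≤ deriv Real.smoothTransition s := by
  have hd : Continuous (deriv Real.smoothTransition) :=
    (Real.smoothTransition.contDiff (n := 1)).continuous_deriv le_rfl
  -- The transition climbs from 0 to 1 on [0, 1], so its slope is 1 somewhere and at least 1/2
  -- nearby.
  obtain ⟨c, hc, hc'⟩ := exists_deriv_eq_slope Real.smoothTransition one_pos
    Real.smoothTransition.continuous.continuousOn
    ((Real.smoothTransition.contDiff (n := 1)).differentiable one_ne_zero).differentiableOn
  have h1 : ∀ᶠ s in 𝓝 c, s ∈ Ioo (0 : ℝ) 1 ∧ 1 / 2 < deriv Real.smoothTransition s :=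
    (isOpen_Ioo.eventually_mem hc).and (hd.continuousAt.eventually_const_lt (by rw [hc']; norm_num))
  obtain ⟨r, hr, h⟩ := Metric.nhds_basis_closedBall.eventually_iff.mp h1
  rw [Real.closedBall_eq_Icc] at h
  exact ⟨c - r, c + r, (h ⟨le_rfl, by linarith⟩).1.1.le, by linarith,
    (h ⟨by linarith, le_rfl⟩).1.2.le, fun s hs => (h hs).2.le⟩

theorem exists_smoothTransition_deriv_le : ∃ M, ∀ s, deriv Real.smoothTransition s ≤ M := by
  have hd : Continuous (deriv Real.smoothTransition) :=
    (Real.smoothTransition.contDiff (n := 1)).continuous_deriv le_rfl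
  obtain ⟨M, hM⟩ := (isCompact_Icc (a := (0 : ℝ)) (b := 1)).bddAbove_image hd.continuousOn
  refine ⟨max M 0, fun s => ?_⟩
  rcases lt_or_ge s 0 with hs | hs
  · have : Real.smoothTransition =ᶠ[𝓝 s] fun _ => 0 := by
      filter_upwards [gt_mem_nhds hs] with r hr using Real.smoothTransition.zero_of_nonpos hr.le
    rw [this.deriv_eq, deriv_const]
    exact le_max_right _ _
  rcases lt_or_ge 1 s with hs' | hs'
  · have : Real.smoothTransition =ᶠ[𝓝 s] fun _ => 1 := by
      filter_upwards [lt_mem_nhds hs'] with r hr using Real.smoothTransition.one_of_one_le hr.le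
    rw [this.deriv_eq, deriv_const]
    exact le_max_right _ _
  · exact (hM ⟨s, ⟨hs, hs'⟩, rfl⟩).trans (le_max_left _ _)

/-- A scale factor that is constant for `s ≤ 0` and whose slope rises from `0` to `ε` within
`[0, δ]`. -/
theorem exists_rosenProfile {ε δ : ℝ} (hε : 0 < ε) (hδ : 0 < δ) :
    ∃ F : RosenProfile, (∀ s ≤ 0, F.P s = 1) ∧ (∀ s ≤ 0, F.P' s = 0) ∧ (∀ s, 0 ≤ F.P' s) ∧
      (∀ s, F.P' s ≤ ε) ∧ (∀ s, 0 ≤ F.P'' s) ∧ (∃ M, ∀ s, F.P'' s ≤ M) ∧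
      (∀ s, F.P'' s = ε * (deriv Real.smoothTransition (s / δ) / δ)) ∧
      (∀ s ≤ 0, F.X s = s) ∧ (∀ s ≤ 0, F.Q s = s) := by
  set D : ℝ → ℝ := fun s => ε * Real.smoothTransition (s / δ) with hD
  have hDs : ContDiff ℝ ∞ D :=
    contDiff_const.mul (Real.smoothTransition.contDiff.comp (contDiff_id.div_const δ))
  have hD' (s : ℝ) : HasDerivAt D (ε * (deriv Real.smoothTransition (s / δ) / δ)) s := by
    have h1 : HasDerivAt Real.smoothTransition (deriv Real.smoothTransition (s / δ)) (s / δ) :=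
      ((Real.smoothTransition.contDiff (n := 1)).differentiable one_ne_zero _).hasDerivAt
    have h2 : HasDerivAt (fun s => s / δ) (1 / δ) s := (hasDerivAt_id s).div_const δ
    refine ((h1.comp s h2).const_mul ε).congr_deriv ?_
    ring
  have hD0 (s : ℝ) : 0 ≤ D s := mul_nonneg hε.le (Real.smoothTransition.nonneg _)
  have hDε (s : ℝ) : D s ≤ ε := mul_le_of_le_one_right hε.le (Real.smoothTransition.le_one _)
  have hDneg (s : ℝ) (hs : s ≤ 0) : D s = 0 := by
    simp [hD, Real.smoothTransition.zero_of_nonpos (div_nonpos_of_nonpos_of_nonneg hs hδ.le)]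
  have hDD (s : ℝ) : 0 ≤ ε * (deriv Real.smoothTransition (s / δ) / δ) :=
    mul_nonneg hε.le (div_nonneg Real.smoothTransition.monotone.deriv_nonneg hδ.le)
  set P : ℝ → ℝ := fun s => 1 + ∫ r in (0 : ℝ)..s, D r with hP
  have hP' (s : ℝ) : HasDerivAt P (D s) s := (hasDerivAt_primitive hDs.continuous s).const_add 1
  have hPs : ContDiff ℝ ∞ P := contDiff_infty_of_hasDerivAt hP' hDs
  have hPneg (s : ℝ) (hs : s ≤ 0) : P s = 1 := by
    have : ∫ r in (0 : ℝ)..s, D r = ∫ r in (0 : ℝ)..s, (0 : ℝ) := by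
      apply intervalIntegral.integral_congr
      intro r hr
      rw [uIcc_of_ge hs] at hr
      exact hDneg r hr.2
    simp [hP, this]
  have hPmono : Monotone P := monotone_of_deriv_nonneg (fun s => (hP' s).differentiableAt)
    fun s => by rw [(hP' s).deriv]; exact hD0 s
  have hP1 (s : ℝ) : 1 ≤ P s := by
    rcases le_total s 0 with hs | hs
    · exact (hPneg s hs).ge
    · exact (hPneg 0 le_rfl).ge.trans (hPmono hs)
  set X : ℝ → ℝ := fun s => ∫ r in (0 : ℝ)..s, P r with hX
  have hX' (s : ℝ) : HasDerivAt X (P s) s := hasDerivAt_primitive hPs.continuous s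
  have hXs : ContDiff ℝ ∞ X := contDiff_infty_of_hasDerivAt hX' hPs
  set Q : ℝ → ℝ := fun s => ∫ r in (0 : ℝ)..s, P r ^ 2 with hQ
  have hQ' (s : ℝ) : HasDerivAt Q (P s ^ 2) s := hasDerivAt_primitive (hPs.pow 2).continuous s
  have hQs : ContDiff ℝ ∞ Q := contDiff_infty_of_hasDerivAt hQ' (hPs.pow 2)
  obtain ⟨S, hSs, hXS, hSX⟩ := exists_contDiff_inverse hX' hP1 hXs
  have hneg {k : ℝ → ℝ} (hk : ∀ r ≤ 0, k r = 1) (s : ℝ) (hs : s ≤ 0) :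
      ∫ r in (0 : ℝ)..s, k r = s := by
    have : ∫ r in (0 : ℝ)..s, k r = ∫ r in (0 : ℝ)..s, (1 : ℝ) := by
      apply intervalIntegral.integral_congr
      intro r hr
      rw [uIcc_of_ge hs] at hr
      exact hk r hr.2
    simp [this]
  obtain ⟨M, hM⟩ := exists_smoothTransition_deriv_le
  exact ⟨⟨P, D, fun s => ε * (deriv Real.smoothTransition (s / δ) / δ), X, S, Q, hP1, hP', hD',
    hX', hQ', hXS, hSX, hPs, hXs, hSs, hQs⟩, hPneg, hDneg, hD0, hDε, hDD,
    ⟨ε * (M / δ), fun s => by have := hM (s / δ); dsimp only; gcongr⟩, fun s => rfl, hneg hPneg,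
    hneg fun r hr => by rw [hPneg r hr, one_pow]⟩

/-! ### The compact box and its volume -/

/-- The linear involution exchanging `(x, y)` and `(ξ, η)`. -/
def xiEtaSwap : Coord 4 →ₗ[ℝ] Coord 4 where
  toFun q := ofXiEta (q 0) (q 1) (q 2) (q 3)
  map_add' q r := by ext i; fin_cases i <;> simp [ofXiEta] <;> ring
  map_smul' a q := by ext i; fin_cases i <;> simp [ofXiEta] <;> ring

theorem xiEtaSwap_apply (q : Coord 4) : xiEtaSwap q = ![q 0, q 1, xi q, eta q] := rfl

theorem xiEtaSwap_xiEtaSwap (q : Coord 4) : xiEtaSwap (xiEtaSwap q) = q := by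
  ext i
  fin_cases i <;> simp [xiEtaSwap, ofXiEta] <;> ring

theorem abs_det_xiEtaSwap : |LinearMap.det xiEtaSwap| = 1 := by
  have h : LinearMap.det xiEtaSwap * LinearMap.det xiEtaSwap = 1 := by
    rw [← LinearMap.det_comp,
      show xiEtaSwap ∘ₗ xiEtaSwap = LinearMap.id from LinearMap.ext xiEtaSwap_xiEtaSwap,
      LinearMap.det_id]
  rcases mul_self_eq_one_iff.mp h with h | h <;> simp [h]

theorem volume_preimage_xiEtaSwap (s : Set (Coord 4)) : volume (xiEtaSwap ⁻¹' s) = volume s := by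
  have h0 : LinearMap.det xiEtaSwap ≠ 0 := fun h => by simpa [h] using abs_det_xiEtaSwap
  rw [Measure.addHaar_preimage_linearMap volume h0, abs_inv, abs_det_xiEtaSwap]
  simp

theorem continuous_xiEtaSwap : Continuous xiEtaSwap := xiEtaSwap.continuous_of_finiteDimensional

/-- The box `[u₀, u₁] × [v₀, v₁] × [x₀, x₁] × [0, 1]` in the coordinates `(u, v, ξ, η)`. -/
def box (u₀ u₁ v₀ v₁ x₀ x₁ : ℝ) : Set (Coord 4) :=
  xiEtaSwap ⁻¹' Icc ![u₀, v₀, x₀, 0] ![u₁, v₁, x₁, 1]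

theorem mem_box {u₀ u₁ v₀ v₁ x₀ x₁ : ℝ} {q : Coord 4} : q ∈ box u₀ u₁ v₀ v₁ x₀ x₁ ↔
    q 0 ∈ Icc u₀ u₁ ∧ q 1 ∈ Icc v₀ v₁ ∧ xi q ∈ Icc x₀ x₁ ∧ eta q ∈ Icc 0 1 := by
  simp only [box, mem_preimage, xiEtaSwap_apply, mem_Icc, Pi.le_def, Fin.forall_fin_succ]
  simp
  tauto

theorem isCompact_box (u₀ u₁ v₀ v₁ x₀ x₁ : ℝ) : IsCompact (box u₀ u₁ v₀ v₁ x₀ x₁) := by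
  have : box u₀ u₁ v₀ v₁ x₀ x₁ = xiEtaSwap '' Icc ![u₀, v₀, x₀, 0] ![u₁, v₁, x₁, 1] :=
    (image_eq_preimage_of_inverse xiEtaSwap_xiEtaSwap xiEtaSwap_xiEtaSwap).symm ▸ rfl
  rw [this]
  exact isCompact_Icc.image continuous_xiEtaSwap

theorem volume_box (u₀ v₀ x₀ x₁ : ℝ) :
    volume (box u₀ (u₀ + 1) v₀ (v₀ + 1) x₀ x₁) = ENNReal.ofReal (x₁ - x₀) := by
  rw [box, volume_preimage_xiEtaSwap, Real.volume_Icc_pi]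
  simp [Fin.prod_univ_four]

theorem measurableSet_box (u₀ u₁ v₀ v₁ x₀ x₁ : ℝ) : MeasurableSet (box u₀ u₁ v₀ v₁ x₀ x₁) :=
  (isCompact_box ..).measurableSet

/-! ### Estimates on the box and verification of the assumptions -/

namespace RosenProfile

variable (F : RosenProfile)

theorem P_le_two {ε : ℝ} (h1 : F.P 0 = 1) (hP0 : ∀ s, 0 ≤ F.P' s) (hP : ∀ s, F.P' s ≤ ε)
    (hε : ε ≤ 1) {s : ℝ} (hs : s ≤ 1) : F.P s ≤ 2 := by
  have hmono : Monotone F.P := monotone_of_deriv_nonneg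
    (fun s => (F.hasDerivAt_P s).differentiableAt) fun s => by
      rw [(F.hasDerivAt_P s).deriv]; exact hP0 s
  have := image_sub_le_mul_sub_of_deriv_le (fun s => (F.hasDerivAt_P s).differentiableAt)
    (fun s => by rw [(F.hasDerivAt_P s).deriv]; exact hP s) zero_le_one
  linarith [hmono hs]

theorem strictMono_X : StrictMono F.X := strictMono_of_deriv_pos fun s => by
  rw [(F.hasDerivAt_X s).deriv]; exact F.P_pos s

/-- A function on `[0, 1]` vanishing at `0` with derivative in `[0, B]` takes values in
`[0, B]`. -/
theorem mem_Icc_of_deriv_le {h g : ℝ → ℝ} {B : ℝ} (hh : ∀ s, HasDerivAt h (g s) s)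
    (h0 : h 0 = 0) (hg : ∀ s ∈ Icc (0 : ℝ) 1, g s ∈ Icc 0 B) {s : ℝ} (hs : s ∈ Icc (0 : ℝ) 1) :
    h s ∈ Icc 0 (B * s) := by
  have hd : DifferentiableOn ℝ h (interior (Icc 0 1)) :=
    fun r _ => (hh r).differentiableAt.differentiableWithinAt
  have hc : ContinuousOn h (Icc 0 1) := fun r _ => (hh r).continuousAt.continuousWithinAt
  have h1 := (convex_Icc (0 : ℝ) 1).image_sub_le_mul_sub_of_deriv_le hc hd (C := B)
    (fun r hr => by rw [(hh r).deriv]; exact (hg r (interior_subset hr)).2) 0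
    ⟨le_rfl, zero_le_one⟩ s hs hs.1
  have h2 := (convex_Icc (0 : ℝ) 1).mul_sub_le_image_sub_of_le_deriv hc hd (C := 0)
    (fun r hr => by rw [(hh r).deriv]; exact (hg r (interior_subset hr)).1) 0
    ⟨le_rfl, zero_le_one⟩ s hs hs.1
  constructor <;> linarith

theorem Q_mem_Icc (h0 : F.Q 0 = 0) (hP : ∀ s ≤ 1, F.P s ≤ 2) {s : ℝ} (hs : s ∈ Icc (0 : ℝ) 1) :
    F.Q s ∈ Icc 0 4 := by
  have := mem_Icc_of_deriv_le F.hasDerivAt_Q h0 (B := 4) (fun r hr => ⟨sq_nonneg _, by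
    nlinarith [F.one_le r, hP r hr.2]⟩) hs
  exact ⟨this.1, by linarith [this.2, hs.2]⟩

theorem S_mem_Icc (h0 : F.X 0 = 0) {z : ℝ} (hz : z ∈ Icc (0 : ℝ) 1) : F.S z ∈ Icc (0 : ℝ) 1 := by
  have h1 := add_le_of_one_le_deriv F.hasDerivAt_X F.one_le zero_le_one
  constructor
  · rw [← F.strictMono_X.le_iff_le, F.X_S, h0]; exact hz.1
  · rw [← F.strictMono_X.le_iff_le, F.X_S]; linarith [hz.2]

/-- A lower bound for the curvature operator in the direction `unitNullVec`. -/
theorem le_curvature_unitNullVec {n m : ℝ} (hn : 0 < n) {q : Coord 4} (hP : F.scale q ≤ 2)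
    (hm : m ≤ F.P'' (F.S (xi q))) (hm0 : 0 ≤ m) :
    m / 2 * (2 * n / 17) ^ 2 ≤ F.f'' (xi q) * (n / (1 / 2 + 2 * F.scale q ^ 2)) ^ 2 := by
  have hp := F.scale_pos q
  have h1 : m / 2 ≤ F.f'' (xi q) := by
    rw [f'', ← scale]
    exact div_le_div₀ (hm0.trans hm) hm hp hP
  have h0 : 0 ≤ F.f'' (xi q) := le_trans (by positivity) h1
  -- P ≤ 2 gives 1/2 + 2P² ≤ 17/2.
  have h2 : 2 * n / 17 ≤ n / (1 / 2 + 2 * F.scale q ^ 2) := by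
    rw [div_le_div_iff₀ (by norm_num) (by positivity)]
    nlinarith [mul_nonneg hn.le (by nlinarith : 0 ≤ 4 - F.scale q ^ 2)]
  gcongr

/-- The quantitative bounds involve only ε. The bound M on P'' serves completeness alone, as a
Lipschitz constant of f', so its size is irrelevant. -/
theorem satisfiesAssumptions {n ε L R ι₀ Kn KRm Kπ Kω M : ℝ} (hn : 0 < n) (hι₀ : 0 < ι₀)
    (hR : R = 2 * ι₀) (hKn : n ≤ Kn) (hKRm : 0 ≤ KRm) (hKπ : 2 * ε ≤ Kπ) (hKω : 4 * ε ≤ Kω)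
    (hL : ε * (n * L) ≤ 1) (hP1 : ∀ s ≤ 0, F.P s = 1) (hP'0 : ∀ s ≤ 0, F.P' s = 0)
    (hP' : ∀ s, 0 ≤ F.P' s) (hP'ε : ∀ s, F.P' s ≤ ε) (hP'' : ∀ s, 0 ≤ F.P'' s)
    (hM : ∀ s, F.P'' s ≤ M) :
    F.metric.SatisfiesAssumptions (m := 3) (F.time n) (F.chart n)
      (F.chart n ![0, 0, -R, 0]) (Icc (-L) 0) ι₀ Kn KRm Kπ Kω where
  lorentzian := MetricField.isLorentzian_planeWave_ridge F.contDiff_f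
  complete := by
    have hlip : LipschitzWith (Real.toNNReal M) F.f' := by
      apply lipschitzWith_of_nnnorm_deriv_le (fun z => (F.hasDerivAt_f' z).differentiableAt)
      intro z
      rw [(F.hasDerivAt_f' z).deriv, ← NNReal.coe_le_coe, coe_nnnorm,
        Real.coe_toNNReal _ ((hP'' 0).trans (hM 0)), f'',
        Real.norm_of_nonneg (div_nonneg (hP'' _) (F.P_pos _).le)]
      exact (div_le_self (hP'' _) (F.one_le _)).trans (hM _)
    exact MetricField.isGeodesicallyComplete_planeWave_ridge F.hasDerivAt_f hlip (M := ε)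
      fun z => by rw [f', abs_of_nonneg (hP' _)]; exact hP'ε _
  transported := F.isTransported hn
  cauchy := F.isCauchy_time hn
  base := F.time_chart hn.ne' _
  injectivity x hx := by
    have h := congrArg (F.chartInv n) hx
    rw [chartInv_chart F hn.ne', chartInv_chart F hn.ne'] at h
    have h0 : x 0 = 0 := congrFun h 1
    have h1 : x 1 = -R := congrFun h 2
    rw [sliceMetric_chart, mul_zero]
    exact F.le_injRadius_warped hP1 hP'0 hι₀ (by rw [h0, h1, hR]; linarith)
  lapse_le q _ := by rw [lapse_time F hn]; exact hKn
  null_curvature q X hX Y hXY :=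
    (MetricField.curvatureForm_planeWave_ridge_nonpos F.hasDerivAt_f F.hasDerivAt_f'
      (fun z => div_nonneg (hP'' _) (F.P_pos _).le) q X Y).trans
      (mul_nonneg hKRm (ip_nonneg_of_isNullConeTangent hn hX hXY))
  deformation_le q _ V := by
    refine (F.abs_deformation_time_le hn hP' hP'ε q V).trans ?_
    apply mul_le_mul_of_nonneg_right hKπ
    rw [refSq_time F hn]
    positivity
  second_deformation_le t ht x a W := by
    intro V _
    refine (F.secondDeformation_chart_le hn hP' hP'ε hL ht x a W).trans ?_
    apply mul_le_mul_of_nonneg_right hKω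
    rw [refSq_time F hn]
    positivity

/-- In transported coordinates the box lies at large a, and its time separation from p exceeds a by
−u ≥ 1. The resulting gain of at least 2A in the squared separation pays for the bounded
displacements in b and η. -/
theorem box_subset_causalPast {n R A : ℝ} (hn : 0 < n) (hR : 0 ≤ R)
    (hA : A = 2 * (3 + R) ^ 2 + 1) (hX0 : F.X 0 = 0) (hQ0 : F.Q 0 = 0)
    (hP : ∀ s ≤ 1, F.P s ≤ 2) :
    box (-2) (-1) (-A - 1) (-A) 0 1 ⊆ F.metric.causalPast (F.time n) (F.chart n ![0, 0, -R, 0]) ∩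
      {q | F.time n q ∈ Icc (-((7 + A) / n)) 0} := by
  intro q hq
  obtain ⟨hu, hv, hx, he⟩ := mem_box.mp hq
  have hS := F.S_mem_Icc hX0 hx
  have hQ := F.Q_mem_Icc hQ0 hP hS
  have hA0 : 0 ≤ A := by rw [hA]; positivity
  constructor
  · rw [← F.chart_chartInv hn.ne' q]
    have ht : F.time n q < 0 := div_neg_of_neg_of_pos (by linarith [hu.2, hv.2, hQ.1]) hn
    apply F.mem_causalPast_chart hn (B := 2)
    · simpa [chartInv] using ht
    · intro s hs
      apply hP
      rw [phase_chartInv F hn.ne'] at hs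
      have h1 : phase n (![0, 0, -R, 0] : Coord 4) = -R := by simp [phase]
      rw [h1] at hs
      have := (convex_Iic (1 : ℝ)).segment_subset (mem_Iic.mpr hS.2)
        (mem_Iic.mpr (by linarith : -R ≤ 1)) hs
      exact this
    · have e : n ^ 2 * ((![0, 0, -R, 0] : Coord 4) 0 - F.chartInv n q 0) ^ 2 =
          (q 0 - (F.Q (F.S (xi q)) - q 1)) ^ 2 := by
        simp [chartInv, time]
        field_simp
        ring
      rw [e]
      simp only [chartInv, Matrix.cons_val_zero, Matrix.cons_val_one, Matrix.cons_val]
      -- The left side is at most a² + 4(3 + R)² + 1 ≤ a² + 2A, whereas (u − a)² contains −2ua ≥ 2A.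
      set a := F.Q (F.S (xi q)) - q 1 with ha
      have ha' : A ≤ a := by rw [ha]; linarith [hQ.1, hv.2]
      have h1 : (-R - (F.S (xi q) - q 0)) ^ 2 ≤ (3 + R) ^ 2 :=
        sq_le_sq' (by linarith [hS.2, hu.1]) (by linarith [hS.1, hu.2])
      have h2 : (0 - eta q) ^ 2 ≤ 1 := by nlinarith [he.1, he.2]
      have h3 : A ≤ -q 0 * a := by nlinarith [hu.2]
      nlinarith [sq_nonneg (q 0)]
  · change F.time n q ∈ Icc _ _
    rw [time]
    constructor
    · rw [← neg_div, div_le_div_iff_of_pos_right hn]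
      linarith [hu.1, hv.1, hQ.2]
    · exact div_nonpos_of_nonpos_of_nonneg (by linarith [hu.2, hv.2, hQ.1]) hn.le

/-- Testing with `unitNullVec` and `screenVec` bounds b below on the slab x₀ ≤ ξ ≤ x₁, whose volume
is x₁ − x₀ because |det g| = 1 and the other edges have length one. Comparing with a constant needs
no measurability of b. -/
theorem le_lintegral_box {n m A x₀ x₁ : ℝ} (hn : 0 < n) (hm0 : 0 ≤ m) (hx₀ : 0 ≤ x₀)
    (hx₁ : x₁ ≤ 1) (hP : ∀ q : Coord 4, xi q ≤ 1 → F.scale q ≤ 2)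
    (hm : ∀ z ∈ Icc x₀ x₁, m ≤ F.P'' (F.S z)) {b : Coord 4 → ℝ}
    (hb : F.metric.CurvatureBoundedBelowBy (F.time n) (box (-2) (-1) (-A - 1) (-A) 0 1) b) :
    ENNReal.ofReal ((m / 2 * (2 * n / 17) ^ 2) ^ 2 * (x₁ - x₀)) ≤
      ∫⁻ q in box (-2) (-1) (-A - 1) (-A) 0 1, ENNReal.ofReal (b q) ^ 2 ∂F.metric.vol := by
  set κ := m / 2 * (2 * n / 17) ^ 2 with hκ
  have hsub : box (-2) (-1) (-A - 1) (-A) x₀ x₁ ⊆ box (-2) (-1) (-A - 1) (-A) 0 1 := by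
    intro q hq
    obtain ⟨hu, hv, hx, he⟩ := mem_box.mp hq
    exact mem_box.mpr ⟨hu, hv, ⟨hx₀.trans hx.1, hx.2.trans hx₁⟩, he⟩
  have hbκ : ∀ q ∈ box (-2) (-1) (-A - 1) (-A) x₀ x₁, κ ≤ b q := by
    intro q hq
    have hx := (mem_box.mp hq).2.2.1
    have h := hb q (hsub hq) _ (F.ip_unitNullVec_self n q) (F.fderiv_time_unitNullVec hn q) _
      (F.ip_unitNullVec_screenVec n q)
    rw [ip_screenVec_self, curvatureForm_unitNullVec] at h
    have := F.le_curvature_unitNullVec hn (hP q (hx.2.trans hx₁)) (hm _ hx) hm0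
    linarith
  have hvol : volume (box (-2) (-1) (-A - 1) (-A) x₀ x₁) = ENNReal.ofReal (x₁ - x₀) := by
    rw [← volume_box (-2) (-A - 1)]
    congr 2 <;> ring
  rw [metric, MetricField.vol_planeWave]
  calc ENNReal.ofReal (κ ^ 2 * (x₁ - x₀))
      = ∫⁻ _ in box (-2) (-1) (-A - 1) (-A) x₀ x₁, ENNReal.ofReal κ ^ 2 := by
        rw [setLIntegral_const, hvol, ← ENNReal.ofReal_pow (by positivity),
          ENNReal.ofReal_mul (by positivity)]
    _ ≤ ∫⁻ q in box (-2) (-1) (-A - 1) (-A) x₀ x₁, ENNReal.ofReal (b q) ^ 2 :=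
        setLIntegral_mono' (measurableSet_box ..) fun q hq => by
          have := hbκ q hq
          gcongr
    _ ≤ _ := lintegral_mono_set hsub

end RosenProfile

end

/-! ### Choice of the constants and conclusion -/

theorem proposition6p1 (ι₀ Kn KRm Kπ Kω : ℝ)
    (hι₀ : 0 < ι₀) (hKn : 0 < Kn) (hKRm : 0 < KRm) (hKπ : 0 < Kπ) (hKω : 0 < Kω) :
    ∃ (p : Coord 4) (L : ℝ) (K : Set (Coord 4)), 1 ≤ L ∧ IsCompact K ∧
      ∀ C : ℝ, ∃ (H : ℝ → ℝ → ℝ → ℝ) (τ : Coord 4 → ℝ) (Φ : Coord 4 → Coord 4),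
        ContDiff ℝ ∞ (fun z : ℝ × ℝ × ℝ => H z.1 z.2.1 z.2.2) ∧
        -- all assumptions of the null injectivity estimate, with the given constants
        (planeWave H).SatisfiesAssumptions (m := 3) τ Φ p (Icc (-L) 0) ι₀ Kn KRm Kπ Kω ∧
        -- the curvature operator is non-positive
        (∀ q, (transverseHessian H q).PosSemidef) ∧
        (∀ q X Y, (planeWave H).ip q X X ≤ 0 → (planeWave H).ip q X Y = 0 →
          (planeWave H).curvatureForm q X Y ≤ 0) ∧
        -- it is below `-C` somewhere along a null geodesic from `p`
        (∃ q X Y, (planeWave H).IsNullConeTangent τ p (Icc (-L) 0) q X ∧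
          (planeWave H).ip q X Y = 0 ∧
          (planeWave H).curvatureForm q X Y < -C * (planeWave H).ip q Y Y) ∧
        -- on the fixed compact set `K` in the past of `p`, every lower bound is large in `L²`
        K ⊆ (planeWave H).causalPast τ p ∩ {q | τ q ∈ Icc (-L) 0} ∧
        (∃ q ∈ K, C < transverseHessian H q 0 0 ∧ C < transverseHessian H q 1 1) ∧
        (∀ b : Coord 4 → ℝ, (planeWave H).CurvatureBoundedBelowBy τ K b →
          ENNReal.ofReal C < ∫⁻ q in K, ENNReal.ofReal (b q) ^ 2 ∂(planeWave H).vol) := by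
  obtain ⟨n, hn, hn1, hnK⟩ : ∃ n : ℝ, 0 < n ∧ n ≤ 1 ∧ n ≤ Kn :=
    ⟨min 1 Kn, lt_min one_pos hKn, min_le_left _ _, min_le_right _ _⟩
  obtain ⟨R, hR⟩ : ∃ R, R = 2 * ι₀ := ⟨_, rfl⟩
  have hR0 : 0 ≤ R := by linarith
  obtain ⟨A, hA⟩ : ∃ A, A = 2 * (3 + R) ^ 2 + 1 := ⟨_, rfl⟩
  have hA0 : 0 ≤ A := by rw [hA]; positivity
  -- ε is fixed before C. The condition ε ≤ 1 gives P ≤ 2 for s ≤ 1, and the last one is ε·nL ≤ 1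
  -- for L = (7 + A)/n.
  obtain ⟨ε, hε, hε1, hεπ, hεω, hεA⟩ : ∃ ε : ℝ, 0 < ε ∧ ε ≤ 1 ∧ 2 * ε ≤ Kπ ∧ 4 * ε ≤ Kω ∧
      ε * (7 + A) ≤ 1 := by
    refine ⟨min (min 1 (Kπ / 2)) (min (Kω / 4) (1 / (7 + A))), by positivity, ?_, ?_, ?_, ?_⟩
    · exact (min_le_left _ _).trans (min_le_left _ _)
    · linarith [(min_le_left (min 1 (Kπ / 2)) (min (Kω / 4) (1 / (7 + A)))).trans
        (min_le_right _ _)]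
    · linarith [(min_le_right (min 1 (Kπ / 2)) (min (Kω / 4) (1 / (7 + A)))).trans
        (min_le_left _ _)]
    · rw [← le_div_iff₀ (by positivity)]
      exact (min_le_right _ _).trans (min_le_right _ _)
  obtain ⟨α, β, hα, hαβ, hβ, hψ⟩ := exists_smoothTransition_deriv_ge
  -- X and Q are the identity for s ≤ 0, so p is the same point for every δ. On the box nτ ≥ −2 − (A
  -- + 1) − 4, whence L.
  refine ⟨ofXiEta 0 (-R) (-R) 0, (7 + A) / n, box (-2) (-1) (-A - 1) (-A) 0 1, ?_,
    isCompact_box .., fun C => ?_⟩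
  · rw [le_div_iff₀ hn]; linarith
  obtain ⟨κ, hκ, hκ0⟩ : ∃ κ, κ = ε / 4 * (2 * n / 17) ^ 2 ∧ 0 < κ := ⟨_, rfl, by positivity⟩
  -- κ/δ will bound the curvature and κ²(β − α)/δ its squared L² norm. The bound δ < 1/2 keeps the
  -- steep region inside ξ ≤ 1.
  obtain ⟨δ, ⟨hδ, hδ1⟩, hC1, hC2⟩ : ∃ δ : ℝ, δ ∈ Ioo (0 : ℝ) (1 / 2) ∧ C < κ * δ⁻¹ ∧
      max C 0 < κ ^ 2 * (β - α) * δ⁻¹ := by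
    have h1 : ∀ᶠ δ in 𝓝[>] (0 : ℝ), δ ∈ Ioo (0 : ℝ) (1 / 2) := Ioo_mem_nhdsGT (by norm_num)
    have h2 := (tendsto_inv_nhdsGT_zero.const_mul_atTop hκ0).eventually_gt_atTop C
    have h3 := (tendsto_inv_nhdsGT_zero.const_mul_atTop (by
      have := sub_pos.mpr hαβ; positivity : 0 < κ ^ 2 * (β - α))).eventually_gt_atTop (max C 0)
    exact (h1.and (h2.and h3)).exists
  obtain ⟨F, hP1, hP'0, hP', hP'ε, hP'', ⟨M, hM⟩, hP''eq, hX, hQ⟩ := exists_rosenProfile hε hδ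
  have hP2 : ∀ s ≤ 1, F.P s ≤ 2 := fun s hs => F.P_le_two (hP1 0 le_rfl) hP' hP'ε hε1 hs
  have hX0 := hX 0 le_rfl
  have hQ0 := hQ 0 le_rfl
  have hm : ∀ s ∈ Icc (δ * α) (δ * β), ε / (2 * δ) ≤ F.P'' s := by
    intro s hs
    have h1 : s / δ ∈ Icc α β :=
      ⟨by rw [le_div_iff₀ hδ]; linarith [hs.1], by rw [div_le_iff₀ hδ]; linarith [hs.2]⟩
    rw [hP''eq, show ε / (2 * δ) = ε * (1 / 2 / δ) by field_simp]
    have := hψ _ h1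
    gcongr
  have hm0 : 0 ≤ ε / (2 * δ) := by positivity
  have hκδ : ε / (2 * δ) / 2 * (2 * n / 17) ^ 2 = κ * δ⁻¹ := by rw [hκ]; field_simp; ring
  have hf''0 (z : ℝ) : 0 ≤ F.f'' z := div_nonneg (hP'' _) (F.P_pos _).le
  have hαmem : δ * α ∈ Icc (δ * α) (δ * β) := ⟨le_rfl, by gcongr⟩
  have hδα : 0 ≤ δ * α := by positivity
  have hδβ : δ * β ≤ 1 / 2 := (mul_le_of_le_one_right hδ.le hβ).trans hδ1.le
  have hδα1 : δ * α ≤ 1 := by linarith [hαmem.2]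
  have hXβ : F.X (δ * β) ≤ 1 := by
    have := RosenProfile.mem_Icc_of_deriv_le F.hasDerivAt_X hX0 (B := 2)
      (fun r hr => ⟨(F.P_pos r).le, hP2 r hr.2⟩) (s := δ * β)
      ⟨hδα.trans hαmem.2, by linarith⟩
    linarith [this.2]
  have hXα0 : 0 ≤ F.X (δ * α) := by rw [← hX0]; exact F.strictMono_X.monotone hδα
  have hXαβ := add_le_of_one_le_deriv F.hasDerivAt_X F.one_le hαmem.2
  have hXα1 : F.X (δ * α) ≤ 1 := (F.strictMono_X.monotone hαmem.2).trans hXβ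
  have hAR : 3 * R + 19 ≤ A := by rw [hA]; nlinarith [sq_nonneg R]
  have hscale (q : Coord 4) (hq : xi q ≤ 1) : F.scale q ≤ 2 := by
    apply hP2
    rw [← F.strictMono_X.le_iff_le, F.X_S]
    have := add_le_of_one_le_deriv F.hasDerivAt_X F.one_le zero_le_one
    linarith
  have hp : F.chart n ![0, 0, -R, 0] = ofXiEta 0 (-R) (-R) 0 := by
    have h1 : RosenProfile.phase n (![0, 0, -R, 0] : Coord 4) = -R := by
      simp [RosenProfile.phase]
    rw [RosenProfile.chart, h1, hX _ (by linarith), hQ _ (by linarith)]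
    simp
  refine ⟨ridge F.f, F.time n, F.chart n, ridge_contDiff F.contDiff_f, ?_, ?_, ?_, ?_, ?_, ?_, ?_⟩
  · rw [← hp]
    exact F.satisfiesAssumptions hn hι₀ hR hnK hKRm.le hεπ hεω
      (by rwa [mul_div_cancel₀ _ hn.ne']) hP1 hP'0 hP' hP'ε hP'' hM
  · exact transverseHessian_ridge_posSemidef F.hasDerivAt_f F.hasDerivAt_f' hf''0
  · exact fun q X Y _ _ => MetricField.curvatureForm_planeWave_ridge_nonpos F.hasDerivAt_f
      F.hasDerivAt_f' hf''0 q X Y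
  · set s := R + δ * α with hs
    have hs' : -R + s = δ * α := by rw [hs]; ring
    have hQα := F.Q_mem_Icc hQ0 hP2 ⟨hδα, hδα1⟩
    have h := F.isNullConeTangent_unitNullVec hn (I := Icc (-((7 + A) / n)) 0) (-R) s (-R + -R)
      (by positivity) (by
        rw [hs', RosenProfile.time, xi_ofXiEta, F.S_X]
        have e0 (u v x e : ℝ) : ofXiEta u v x e 0 = u := rfl
        have e1 (u v x e : ℝ) : ofXiEta u v x e 1 = v := rfl
        rw [e0, e1]
        constructor
        · rw [← neg_div, div_le_div_iff_of_pos_right hn]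
          linarith [hQα.2]
        · exact div_nonpos_of_nonpos_of_nonneg (by linarith [hQα.1]) hn.le)
    rw [hs', hX (-R) (by linarith), hQ (-R) (by linarith), add_sub_cancel_right] at h
    refine ⟨_, _, F.screenVec _, h, F.ip_unitNullVec_screenVec n _, ?_⟩
    have h1 := F.curvatureForm_unitNullVec n
      (ofXiEta (-s) (-R + -R + s / 2 - F.Q (δ * α)) (F.X (δ * α)) 0)
    have h2 := F.ip_screenVec_self
      (ofXiEta (-s) (-R + -R + s / 2 - F.Q (δ * α)) (F.X (δ * α)) 0)
    have h3 := F.le_curvature_unitNullVec hn (m := ε / (2 * δ))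
      (q := ofXiEta (-s) (-R + -R + s / 2 - F.Q (δ * α)) (F.X (δ * α)) 0)
      (hscale _ (by rwa [xi_ofXiEta])) (by rw [xi_ofXiEta, F.S_X]; exact hm _ hαmem) hm0
    rw [RosenProfile.metric] at h1 h2
    rw [h1, h2]
    linarith
  · rw [← hp]
    exact F.box_subset_causalPast hn hR0 hA hX0 hQ0 hP2
  · refine ⟨ofXiEta (-1) (-A) (F.X (δ * α)) 0, mem_box.mpr ⟨?_, ?_, ?_, ?_⟩, ?_⟩
    · exact ⟨by norm_num [ofXiEta], le_rfl⟩
    · exact ⟨by simp [ofXiEta], le_rfl⟩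
    · rw [xi_ofXiEta]; exact ⟨hXα0, hXα1⟩
    · rw [eta_ofXiEta]; exact ⟨le_rfl, zero_le_one⟩
    have h1 : ε / (2 * δ) / 2 ≤ F.f'' (F.X (δ * α)) := by
      rw [RosenProfile.f'', F.S_X]
      exact div_le_div₀ (hP'' _) (hm _ hαmem) (F.P_pos _) (hP2 _ hδα1)
    -- 9/25 is the smaller of the two diagonal weights of the Hessian, so the curvature bound κ/δ >
    -- C also covers both second derivatives.
    have h2 : (2 * n / 17) ^ 2 ≤ (3 / 5) ^ 2 := pow_le_pow_left₀ (by positivity) (by linarith) 2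
    have h3 : κ * δ⁻¹ ≤ ε / (2 * δ) / 2 * (3 / 5) ^ 2 := by
      rw [← hκδ]; gcongr
    have h4 := hf''0 (F.X (δ * α))
    change C < pd 2 (pd 2 (profile (ridge F.f))) _ ∧ C < pd 3 (pd 3 (profile (ridge F.f))) _
    rw [pd_pd_profile_ridge F.hasDerivAt_f F.hasDerivAt_f',
      pd_pd_profile_ridge F.hasDerivAt_f F.hasDerivAt_f', xi_ofXiEta,
      show dxi 2 = 3 / 5 from rfl, show dxi 3 = 4 / 5 from rfl]
    constructor <;> linarith
  · intro b hb
    have h := F.le_lintegral_box hn hm0 hXα0 hXβ hscale (fun z hz => hm _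
      ⟨by rw [← F.strictMono_X.le_iff_le, F.X_S]; exact hz.1,
        by rw [← F.strictMono_X.le_iff_le, F.X_S]; exact hz.2⟩) hb
    refine lt_of_lt_of_le ?_ h
    rw [hκδ]
    -- Height κ/δ squared times width; the width in ξ is at least δ(β − α) because X' ≥ 1.
    have h1 : κ ^ 2 * (β - α) * δ⁻¹ ≤ (κ * δ⁻¹) ^ 2 * (F.X (δ * β) - F.X (δ * α)) := by
      have h2 : κ ^ 2 * (β - α) * δ⁻¹ = (κ * δ⁻¹) ^ 2 * (δ * β - δ * α) := by field_simp
      rw [h2]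
      exact mul_le_mul_of_nonneg_left (by linarith) (sq_nonneg _)
    have h3 := hC2.trans_le h1
    exact (ENNReal.ofReal_lt_ofReal_iff ((le_max_right _ _).trans_lt h3)).mpr
      ((le_max_left _ _).trans_lt h3)
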